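/- Let $\xi\in(0,1)$ and consider Langer's equation $$y'''(\theta)=\theta\,y'(\theta)+(1-\xi)\,y(\theta),\qquad \theta\in\mathbb R. \tag{L}$$ For every $\theta\in\mathbb R$ the integrals $$\mathrm{La}_\xi(\theta)=\int_0^\infty e^{-\tau^3/3+\theta\tau}\tau^{-\xi}\,d\tau,\qquad \mathrm{Lb}_\xi(\theta)=\int_0^\infty \cos\!\Big(\frac{\tau^3}{3}+\theta\tau+\frac{\xi\pi}{2}\Big)\tau^{-\xi}\,d\tau,\qquad \mathrm{Lc}_\xi(\theta)=\int_0^\infty \cos\!\Big(\frac{\tau^3}{3}+\theta\tau-\frac{\xi\pi}{2}\Big)\tau^{-\xi}\,d\tau$$ converge (the first absolutely, the other two as improper integrals $\lim_{R\to\infty}\int_0^R$). The functions $\mathrm{La}_\xi,\mathrm{Lb}_\xi,\mathrm{Lc}_\xi$ are linearly independent and span the space of real solutions of (L) on $\mathbb R$. Call a solution non-oscillatory as $\theta\to-\infty$ if it is monotone on some half-line $(-\infty,T]$. Then the solutions that are non-oscillatory as $\theta\to-\infty$ are exactly the elements of $\mathrm{span}\{\mathrm{La}_\xi\}$. For $\theta<0$,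 $$\mathrm{La}_\xi(\theta)=(-\theta)^{-(1-\xi)}E_2\big((-\theta)^{-3}\big),$$ where $E_2$ is real analytic on $(0,\infty)$, is $C^\infty$ on $[0,\infty)$ (one-sided at $0$), and $E_2(0)=\Gamma(1-\xi)$. As $\theta\to\infty$, $$\mathrm{La}_\xi(\theta)=\sqrt\pi\,\theta^{(1-\xi)/2-3/4}e^{2\theta^{3/2}/3}(1+o(1)),\qquad \mathrm{Lb}_\xi(\theta)=\frac{\sqrt\pi}{2}\,\theta^{(1-\xi)/2-3/4}e^{-2\theta^{3/2}/3}(1+o(1)),$$ $$\mathrm{Lc}_\xi(\theta)=\sin(\xi\pi)\,\Gamma(1-\xi)\,\theta^{-(1-\xi)}(1+o(1)).$$ As $\theta\to-\infty$, $$\mathrm{La}_\xi(\theta)=(-\theta)^{-(1-\xi)}\Gamma(1-\xi)\big(1+O(\theta^{-3})\big),$$ $$\mathrm{Lb}_\xi(\theta)=\sqrt{\pi}\,(-\theta)^{(1-\xi)/2-3/4}\sin\!\Big(\tfrac23(-\theta)^{3/2}\big(1+o(|\theta|^{-3/2})\big)+\frac\pi4-\frac{\xi\pi}2\Big)(1+o(1))+\sin(\xi\pi)\,\mathrm{La}_\xi(\theta),$$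 $$\mathrm{Lc}_\xi(\theta)=\sqrt{\pi}\,(-\theta)^{(1-\xi)/2-3/4}\sin\!\Big(\tfrac23(-\theta)^{3/2}\big(1+o(|\theta|^{-3/2})\big)+\frac\pi4+\frac{\xi\pi}2\Big)(1+o(1)).$$ -/

import Mathlib

open Filter Topology Asymptotics MeasureTheory Set
open scoped ContDiff

namespace Langer

/-- `y : ℝ → ℝ` is a solution on all of `ℝ` of `y''' = θ y' + (1 - ξ) y`. -/
def IsSolution (ξ : ℝ) (y : ℝ → ℝ) : Prop :=
  ContDiff ℝ 3 y ∧
    ∀ θ : ℝ, iteratedDeriv 3 y θ = θ * deriv y θ + (1 - ξ) * y θ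

/-- `y` is non-oscillatory as `θ → -∞`: it is monotone on some left half-line. -/
def NonOscillatoryAtBot (y : ℝ → ℝ) : Prop :=
  ∃ T : ℝ, MonotoneOn y (Iic T) ∨ AntitoneOn y (Iic T)

/-- The improper integral `∫₀^∞ f` converges to `l`, i.e. `∫₀^R f → l` as `R → ∞`. -/
def HasImproperIntegral (f : ℝ → ℝ) (l : ℝ) : Prop :=
  (∀ R : ℝ, 0 < R → IntervalIntegrable f volume 0 R) ∧
    Tendsto (fun R : ℝ => ∫ τ in (0 : ℝ)..R, f τ) atTop (𝓝 l)

noncomputable section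

/-- Integrand of `La`. -/
def laIntegrand (ξ θ τ : ℝ) : ℝ := Real.exp (-τ ^ 3 / 3 + θ * τ) * τ ^ (-ξ)

/-- Integrand of `Lb`. -/
def lbIntegrand (ξ θ τ : ℝ) : ℝ :=
  Real.cos (τ ^ 3 / 3 + θ * τ + ξ * Real.pi / 2) * τ ^ (-ξ)

/-- Integrand of `Lc`. -/
def lcIntegrand (ξ θ τ : ℝ) : ℝ :=
  Real.cos (τ ^ 3 / 3 + θ * τ - ξ * Real.pi / 2) * τ ^ (-ξ)

/-- `La_ξ(θ) = ∫₀^∞ exp(-τ³/3 + θ τ) τ^{-ξ} dτ` (absolutely convergent). -/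
def La (ξ θ : ℝ) : ℝ := ∫ τ in Ioi (0 : ℝ), laIntegrand ξ θ τ

/-- `Lb_ξ(θ) = ∫₀^∞ cos(τ³/3 + θ τ + ξπ/2) τ^{-ξ} dτ`, conditionally convergent, hence the limit
of the integrals over `[0, R]`. -/
def Lb (ξ θ : ℝ) : ℝ :=
  limUnder atTop (fun R : ℝ => ∫ τ in (0 : ℝ)..R, lbIntegrand ξ θ τ)

/-- `Lc_ξ(θ) = ∫₀^∞ cos(τ³/3 + θ τ - ξπ/2) τ^{-ξ} dτ`, conditionally convergent, hence the limit
of the integrals over `[0, R]`. -/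
def Lc (ξ θ : ℝ) : ℝ :=
  limUnder atTop (fun R : ℝ => ∫ τ in (0 : ℝ)..R, lcIntegrand ξ θ τ)

end

end Langer

/-!
All solutions of Langer's equation come from the single entire function
`M(z) = ∫₀^∞ exp(-r³/3 + z r) r^(-ξ) dr` (`airyMoment (-ξ)`). Integrating a total derivative gives
`M''' = z M' + (1 - ξ) M` (`airyMoment_recurrence`), and the equation is invariant under
`z ↦ a z` with `a³ = 1`. Thus `La = M` on the real line, while rotating the contour by `π/6`
identifies `Lb` and `Lc` with real parts of constant multiples of `M(ω θ)`, `ω = exp(2πi/3)`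
(`tendsto_oscillatory`); this is also what makes the two improper integrals converge.

Contours are moved by means of a primitive of `exp(t³/3 - z t) t^(-ξ)` on the right half-plane
(`exists_primitive_mul_cpow`): an integral along a path is a difference of boundary values, and
exponential smallness of the kernel on horizontal segments gives the same limit at infinity along a
vertical line as along a ray `arg t = ± π/3`. For the vertical line through the saddle point `p`
of `t³/3 - p² t` this yields a linear relation between `M(-p² exp(iπ/3))`, `M(-p² exp(-iπ/3))` and a
perturbed Gaussian integral (`saddleIntegral_eq`), whose size as `p → ∞` along a ray follows from
scaling and dominated convergence (`tendsto_saddleIntegral`). The rays `arg p = 0` and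
`arg p = -π/3` give `Lb` and `La` at `+∞`. The ray `arg p = π/6` gives `M(ω θ)` at `-∞` as a
multiple of `La` plus a modulated exponential (`airyMoment_cubeRoot_neg`), hence the oscillation of
`Lb` and `Lc`; an additive error of a sine is moved into its phase and a relative error of the
amplitude by the uniform continuity of `arcsin` (`exists_phase_shift`). In the remaining cases, `Lc`
at `+∞` and `La` at `-∞`, the integral concentrates at `r = 0` after rescaling, which produces the
Gamma function. For `La` the rescaled integral is the function `E₂`: it is `laplaceCube (-ξ)`, smooth
up to `0` by differentiation under the integral sign and analytic on `(0, ∞)` because `M` is entire.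

For the non-oscillatory solutions, a combination of the three functions is compared at consecutive
points of `(-∞, 0)` at which the phase `2/3 (-θ)^(3/2)` grows by `π`. The increments of the
oscillating part alternate in sign and dominate those of `La` (`tendsto_increment`), so a monotone
combination contains neither `Lb` nor `Lc` (`coeff_eq_zero_of_nonOscillatory`); conversely `La` is
increasing. Linear independence is the case of the zero function, and the span is the whole solution
space because solutions are determined by their initial data at `0` (`IsSolution.eq_zero`).
-/

namespace Langer

/-! ### Moments of the cubic exponential -/

noncomputable section

/-- The entire function `z ↦ ∫₀^∞ exp(-r³/3 + z r) r^s dr`, for real `s > -1`. -/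
def airyMoment (s : ℝ) (z : ℂ) : ℂ :=
  ∫ r in Ioi (0 : ℝ), Complex.exp (-(r : ℂ) ^ 3 / 3 + z * r) * ((r ^ s : ℝ) : ℂ)

/-- The cubic absorbs any linear term, so that the kernel is dominated by a decaying exponential. -/
theorem neg_cube_add_mul_le (a : ℝ) {r : ℝ} (hr : 0 ≤ r) :
    -r ^ 3 / 3 + a * r ≤ 3 * (|a| + 1) * (|a| + 2) - r := by
  have ha := le_abs_self a
  have ha0 := abs_nonneg a
  have h1 : a * r ≤ |a| * r := mul_le_mul_of_nonneg_right ha hr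
  rcases le_total r (3 * (|a| + 1)) with h | h
  · have : 0 ≤ r ^ 3 := by positivity
    nlinarith [mul_le_mul_of_nonneg_left h (by positivity : 0 ≤ |a| + 1)]
  · have h2 : 3 * (|a| + 1) ≤ r ^ 2 := by nlinarith
    have h3 : 3 * (|a| + 1) * r ≤ r ^ 2 * r := mul_le_mul_of_nonneg_right h2 hr
    nlinarith

theorem norm_airyMoment_integrand (s : ℝ) (z : ℂ) {r : ℝ} (hr : 0 < r) :
    ‖Complex.exp (-(r : ℂ) ^ 3 / 3 + z * r) * ((r ^ s : ℝ) : ℂ)‖ =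
      Real.exp (-r ^ 3 / 3 + z.re * r) * r ^ s := by
  rw [norm_mul, Complex.norm_exp, Complex.norm_real, Real.norm_of_nonneg (by positivity)]
  congr 2
  have : (-(r : ℂ) ^ 3 / 3 + z * r) = ((-r ^ 3 / 3 : ℝ) : ℂ) + z * r := by push_cast; ring
  rw [this, Complex.add_re, Complex.ofReal_re, Complex.re_mul_ofReal]

theorem integrableOn_exp_neg_mul_rpow {s : ℝ} (hs : -1 < s) (C : ℝ) :
    IntegrableOn (fun r : ℝ => Real.exp (C - r) * r ^ s) (Ioi 0) := by
  have := (integrableOn_rpow_mul_exp_neg_rpow hs one_pos).const_mul (Real.exp C)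
  refine IntegrableOn.congr_fun this (fun r _ => ?_) measurableSet_Ioi
  simp only [Real.rpow_one]
  rw [sub_eq_add_neg, Real.exp_add]; ring

theorem aestronglyMeasurable_airyMoment_integrand (s : ℝ) (z : ℂ) :
    AEStronglyMeasurable
      (fun r : ℝ => Complex.exp (-(r : ℂ) ^ 3 / 3 + z * r) * ((r ^ s : ℝ) : ℂ))
      (volume.restrict (Ioi (0 : ℝ))) := by
  apply Measurable.aestronglyMeasurable
  fun_prop

theorem norm_airyMoment_integrand_le (s : ℝ) {z : ℂ} {A : ℝ} (hz : ‖z‖ ≤ A) {r : ℝ} (hr : 0 < r) :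
    ‖Complex.exp (-(r : ℂ) ^ 3 / 3 + z * r) * ((r ^ s : ℝ) : ℂ)‖ ≤
      Real.exp (3 * (|A| + 1) * (|A| + 2) - r) * r ^ s := by
  rw [norm_airyMoment_integrand s z hr]
  gcongr
  have h1 : z.re * r ≤ A * r :=
    mul_le_mul_of_nonneg_right ((Complex.re_le_norm z).trans hz) hr.le
  linarith [neg_cube_add_mul_le A hr.le]

theorem integrableOn_airyMoment {s : ℝ} (hs : -1 < s) (z : ℂ) :
    IntegrableOn (fun r : ℝ => Complex.exp (-(r : ℂ) ^ 3 / 3 + z * r) * ((r ^ s : ℝ) : ℂ))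
      (Ioi 0) := by
  refine Integrable.mono'
    (integrableOn_exp_neg_mul_rpow hs (3 * (|‖z‖| + 1) * (|‖z‖| + 2)))
    (aestronglyMeasurable_airyMoment_integrand s z) ?_
  filter_upwards [ae_restrict_mem measurableSet_Ioi] with r hr
  exact norm_airyMoment_integrand_le s le_rfl hr

theorem hasDerivAt_airyMoment {s : ℝ} (hs : -1 < s) (z : ℂ) :
    HasDerivAt (airyMoment s) (airyMoment (s + 1) z) z := by
  have key := hasDerivAt_integral_of_dominated_loc_of_deriv_le
    (μ := volume.restrict (Ioi (0 : ℝ))) (x₀ := z) (s := Metric.ball z 1)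
    (F := fun z (r : ℝ) => Complex.exp (-(r : ℂ) ^ 3 / 3 + z * r) * ((r ^ s : ℝ) : ℂ))
    (F' := fun z (r : ℝ) =>
      Complex.exp (-(r : ℂ) ^ 3 / 3 + z * r) * ((r ^ (s + 1) : ℝ) : ℂ))
    (bound := fun r => Real.exp (3 * (|‖z‖ + 1| + 1) * (|‖z‖ + 1| + 2) - r) * r ^ (s + 1))
    (Metric.ball_mem_nhds z one_pos)
    (Eventually.of_forall fun w => aestronglyMeasurable_airyMoment_integrand s w)
    (integrableOn_airyMoment hs z) (aestronglyMeasurable_airyMoment_integrand (s + 1) z)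
    ?_ (integrableOn_exp_neg_mul_rpow (by linarith) _) ?_
  · exact key.2
  · filter_upwards [ae_restrict_mem measurableSet_Ioi] with r hr w hw
    refine norm_airyMoment_integrand_le (s + 1) ?_ hr
    have := norm_le_norm_add_norm_sub' w z
    rw [Metric.mem_ball, dist_eq_norm] at hw
    linarith
  · filter_upwards [ae_restrict_mem measurableSet_Ioi] with r hr w _
    have h1 : HasDerivAt (fun w : ℂ => -(r : ℂ) ^ 3 / 3 + w * r) (1 * (r : ℂ)) w :=
      ((hasDerivAt_id w).mul_const (r : ℂ)).const_add _
    convert! h1.cexp.mul_const ((r ^ s : ℝ) : ℂ) using 1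
    rw [Real.rpow_add hr, Real.rpow_one]
    push_cast; ring

/-- Integrating the derivative of `exp(-r³/3 + z r) r^(s+1)` over the half-line relates three
moments; this is Langer's equation for `airyMoment s` when `s = -ξ`. -/
theorem airyMoment_recurrence {s : ℝ} (hs : -1 < s) (z : ℂ) :
    airyMoment (s + 3) z = z * airyMoment (s + 1) z + (s + 1 : ℝ) * airyMoment s z := by
  have h0 := integrableOn_airyMoment hs z
  have h1 := integrableOn_airyMoment (by linarith : -1 < s + 1) z
  have h3 := integrableOn_airyMoment (by linarith : -1 < s + 3) z
  have hsum := ((h0.const_mul ((s + 1 : ℝ) : ℂ)).add (h1.const_mul z)).sub h3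
  have hcont : ContinuousWithinAt (fun r : ℝ =>
      Complex.exp (-(r : ℂ) ^ 3 / 3 + z * r) * ((r ^ (s + 1) : ℝ) : ℂ)) (Ici 0) 0 := by
    apply ContinuousAt.continuousWithinAt
    have : ContinuousAt (fun r : ℝ => r ^ (s + 1)) 0 :=
      Real.continuousAt_rpow_const _ _ (Or.inr (by linarith))
    have h' : ContinuousAt (fun r : ℝ => ((r ^ (s + 1) : ℝ) : ℂ)) 0 :=
      Complex.continuous_ofReal.continuousAt.comp this
    exact ContinuousAt.mul (by fun_prop) h'
  have hlim : Tendsto (fun r : ℝ =>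
      Complex.exp (-(r : ℂ) ^ 3 / 3 + z * r) * ((r ^ (s + 1) : ℝ) : ℂ)) atTop (𝓝 0) := by
    have ht := (tendsto_rpow_mul_exp_neg_mul_atTop_nhds_zero (s + 1) 1 one_pos).const_mul
      (Real.exp (3 * (|‖z‖| + 1) * (|‖z‖| + 2)))
    rw [mul_zero] at ht
    refine squeeze_zero_norm' ?_ ht
    filter_upwards [eventually_gt_atTop 0] with r hr
    refine (norm_airyMoment_integrand_le (s + 1) le_rfl hr).trans (le_of_eq ?_)
    rw [sub_eq_add_neg, Real.exp_add, neg_one_mul]; ring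
  have key := integral_Ioi_of_hasDerivAt_of_tendsto hcont (f' := fun r : ℝ =>
      ((s + 1 : ℝ) : ℂ) * (Complex.exp (-(r : ℂ) ^ 3 / 3 + z * r) * ((r ^ s : ℝ) : ℂ)) +
      z * (Complex.exp (-(r : ℂ) ^ 3 / 3 + z * r) * ((r ^ (s + 1) : ℝ) : ℂ)) -
      Complex.exp (-(r : ℂ) ^ 3 / 3 + z * r) * ((r ^ (s + 3) : ℝ) : ℂ)) ?_ hsum hlim
  · have e1 : ∫ r in Ioi (0 : ℝ),
      (((s + 1 : ℝ) : ℂ) * (Complex.exp (-(r : ℂ) ^ 3 / 3 + z * r) * ((r ^ s : ℝ) : ℂ)) +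
      z * (Complex.exp (-(r : ℂ) ^ 3 / 3 + z * r) * ((r ^ (s + 1) : ℝ) : ℂ)) -
      Complex.exp (-(r : ℂ) ^ 3 / 3 + z * r) * ((r ^ (s + 3) : ℝ) : ℂ)) =
      ((s + 1 : ℝ) : ℂ) * airyMoment s z + z * airyMoment (s + 1) z - airyMoment (s + 3) z := by
      have i1 := integral_sub ((h0.const_mul ((s + 1 : ℝ) : ℂ)).add (h1.const_mul z)) h3
      have i2 := integral_add (h0.const_mul ((s + 1 : ℝ) : ℂ)) (h1.const_mul z)
      simp only [Pi.add_apply] at i1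
      unfold airyMoment
      rw [i1, i2, integral_const_mul, integral_const_mul]
    rw [e1] at key
    have h00 : (0 : ℝ) ^ (s + 1) = 0 := Real.zero_rpow (by linarith)
    rw [h00] at key
    simp only [Complex.ofReal_zero, mul_zero, sub_zero] at key
    linear_combination -key
  · intro r hr
    have hr : 0 < r := hr
    have d1 : HasDerivAt (fun r : ℝ => (r : ℂ)) 1 r := Complex.ofRealCLM.hasDerivAt
    have d2 := ((((d1.pow 3).neg.div_const 3).add (d1.const_mul z)).cexp).mul
      (Real.hasDerivAt_rpow_const (p := s + 1) (Or.inl hr.ne')).ofReal_comp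
    convert! d2 using 1
    rw [Real.rpow_add hr, Real.rpow_add hr]
    have e : s + 1 - 1 = s := by ring
    rw [e, show (3 : ℝ) = ((3 : ℕ) : ℝ) by norm_num, Real.rpow_natCast, Real.rpow_one]
    push_cast
    simp
    ring

/-- Differentiating the real part of a rotated moment raises its order by one. -/
theorem hasDerivAt_re_airyMoment {s : ℝ} (hs : -1 < s) (c a : ℂ) (θ : ℝ) :
    HasDerivAt (fun θ : ℝ => (c * airyMoment s (a * θ)).re)
      ((c * a * airyMoment (s + 1) (a * θ)).re) θ := by
  have d1 : HasDerivAt (fun r : ℝ => a * (r : ℂ)) (a * 1) θ :=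
    Complex.ofRealCLM.hasDerivAt.const_mul a
  have d2 := ((hasDerivAt_airyMoment hs (a * θ)).comp θ d1).const_mul c
  have d3 := Complex.reCLM.hasFDerivAt.comp_hasDerivAt θ d2
  convert! d3 using 1
  simp only [Complex.reCLM_apply]
  congr 1; ring

theorem contDiff_re_airyMoment (n : ℕ) : ∀ {s : ℝ}, -1 < s → ∀ c a : ℂ,
    ContDiff ℝ n (fun θ : ℝ => (c * airyMoment s (a * θ)).re) := by
  induction n with
  | zero =>
    intro s hs c a
    refine contDiff_zero.2 (continuous_iff_continuousAt.2 fun θ => ?_)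
    exact (hasDerivAt_re_airyMoment hs c a θ).continuousAt
  | succ n ih =>
    intro s hs c a
    have hd := hasDerivAt_re_airyMoment hs c a
    rw [show ((n + 1 : ℕ) : WithTop ℕ∞) = (n : WithTop ℕ∞) + 1 by push_cast; rfl]
    refine contDiff_succ_iff_deriv.2 ⟨fun θ => (hd θ).differentiableAt, by simp, ?_⟩
    rw [show deriv (fun θ : ℝ => (c * airyMoment s (a * θ)).re) =
      fun θ : ℝ => (c * a * airyMoment (s + 1) (a * θ)).re from funext fun θ => (hd θ).deriv]
    exact ih (by linarith) (c * a) a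

/-- Since `a³ = 1`, rotating the argument by `a` preserves Langer's equation. -/
theorem isSolution_re_airyMoment {ξ : ℝ} (hξ1 : ξ < 1) (c : ℂ) {a : ℂ} (ha : a ^ 3 = 1) :
    IsSolution ξ (fun θ : ℝ => (c * airyMoment (-ξ) (a * θ)).re) := by
  have hs : -1 < -ξ := by linarith
  refine ⟨contDiff_re_airyMoment 3 hs c a, fun θ => ?_⟩
  have e1 : deriv (fun θ : ℝ => (c * airyMoment (-ξ) (a * θ)).re) =
      fun θ : ℝ => (c * a * airyMoment (-ξ + 1) (a * θ)).re :=
    funext fun θ => (hasDerivAt_re_airyMoment hs c a θ).deriv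
  have e2 : deriv (fun θ : ℝ => (c * a * airyMoment (-ξ + 1) (a * θ)).re) =
      fun θ : ℝ => (c * a * a * airyMoment (-ξ + 1 + 1) (a * θ)).re :=
    funext fun θ => (hasDerivAt_re_airyMoment (by linarith) (c * a) a θ).deriv
  have e3 : deriv (fun θ : ℝ => (c * a * a * airyMoment (-ξ + 1 + 1) (a * θ)).re) =
      fun θ : ℝ => (c * a * a * a * airyMoment (-ξ + 1 + 1 + 1) (a * θ)).re :=
    funext fun θ => (hasDerivAt_re_airyMoment (by linarith) (c * a * a) a θ).deriv
  rw [iteratedDeriv_succ, iteratedDeriv_succ, iteratedDeriv_one, e1, e2, e3]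
  have hrec := airyMoment_recurrence hs (a * θ)
  rw [show -ξ + 1 + 1 + 1 = -ξ + 3 by ring]
  beta_reduce
  rw [hrec, show (1 - ξ : ℝ) = -ξ + 1 by ring, ← Complex.re_ofReal_mul,
    ← Complex.re_ofReal_mul, ← Complex.add_re]
  congr 1
  push_cast
  linear_combination (c * a * θ * airyMoment (-ξ + 1) (a * θ) +
    c * (1 - ξ) * airyMoment (-ξ) (a * θ)) * ha

theorem laIntegrand_eq_re (ξ θ : ℝ) (τ : ℝ) :
    ((laIntegrand ξ θ τ : ℝ) : ℂ) =
      Complex.exp (-(τ : ℂ) ^ 3 / 3 + (θ : ℂ) * τ) * ((τ ^ (-ξ) : ℝ) : ℂ) := by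
  unfold laIntegrand
  push_cast
  ring_nf

theorem La_eq_airyMoment (ξ θ : ℝ) : ((La ξ θ : ℝ) : ℂ) = airyMoment (-ξ) θ := by
  unfold La airyMoment
  rw [← integral_complex_ofReal]
  simp_rw [laIntegrand_eq_re]

theorem integrableOn_laIntegrand {ξ : ℝ} (hξ1 : ξ < 1) (θ : ℝ) :
    IntegrableOn (laIntegrand ξ θ) (Ioi 0) := by
  have h := (integrableOn_airyMoment (by linarith : -1 < -ξ) θ).re
  refine IntegrableOn.congr_fun h (fun r _ => ?_) measurableSet_Ioi
  simp only [← laIntegrand_eq_re]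
  simp

theorem airyMoment_conj (s : ℝ) (z : ℂ) :
    airyMoment s (starRingEnd ℂ z) = starRingEnd ℂ (airyMoment s z) := by
  unfold airyMoment
  rw [← integral_conj]
  congr 1
  ext r
  simp [← Complex.exp_conj, Complex.conj_ofNat]

end

/-! ### Primitives on the right half-plane and integrals along rays -/

noncomputable section

theorem norm_cpow_neg_ofReal (t : ℂ) (ξ : ℝ) : ‖t ^ (-(ξ : ℂ))‖ = ‖t‖ ^ (-ξ) := by
  rw [← Complex.ofReal_neg, Complex.norm_cpow_real]

theorem ofReal_mul_cpow {r : ℝ} (hr : 0 < r) {u : ℂ} (hu : u ≠ 0) (ξ : ℝ) :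
    ((r : ℂ) * u) ^ (-(ξ : ℂ)) = ((r ^ (-ξ) : ℝ) : ℂ) * u ^ (-(ξ : ℂ)) := by
  have hr' : (r : ℂ) ≠ 0 := Complex.ofReal_ne_zero.2 hr.ne'
  rw [Complex.cpow_def_of_ne_zero (mul_ne_zero hr' hu), Complex.cpow_def_of_ne_zero hu,
    Complex.log_ofReal_mul hr hu, Complex.ofReal_cpow hr.le, Complex.cpow_def_of_ne_zero hr',
    ← Complex.exp_add, ← Complex.ofReal_log hr.le]
  push_cast
  ring_nf

theorem ne_zero_of_re_pos {t : ℂ} (ht : 0 < t.re) : t ≠ 0 := by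
  rintro rfl; simp at ht

theorem norm_cpow_neg_le {ξ c : ℝ} (hξ0 : 0 ≤ ξ) (hc : 0 < c) {t : ℂ} (ht : c ≤ t.re) :
    ‖t ^ (-(ξ : ℂ))‖ ≤ c ^ (-ξ) := by
  rw [norm_cpow_neg_ofReal]
  exact Real.rpow_le_rpow_of_nonpos hc (ht.trans (Complex.re_le_norm t)) (by linarith)

theorem norm_sub_le_of_forall_segment {F f : ℂ → ℂ} {a b : ℂ} {C : ℝ}
    (hF : ∀ t ∈ segment ℝ a b, HasDerivAt F (f t) t) (hC : ∀ t ∈ segment ℝ a b, ‖f t‖ ≤ C) :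
    ‖F b - F a‖ ≤ C * ‖b - a‖ :=
  Convex.norm_image_sub_le_of_norm_hasDerivWithin_le (fun t ht => (hF t ht).hasDerivWithinAt) hC
    (convex_segment a b) (left_mem_segment ℝ a b) (right_mem_segment ℝ a b)

theorem le_re_of_mem_segment {a b t : ℂ} {c : ℝ} (ha : c ≤ a.re) (hb : c ≤ b.re)
    (ht : t ∈ segment ℝ a b) : c ≤ t.re :=
  (convex_halfSpace_re_ge c).segment_subset ha hb ht

theorem norm_le_of_mem_segment {a b t : ℂ} {c : ℝ} (ha : ‖a‖ ≤ c) (hb : ‖b‖ ≤ c)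
    (ht : t ∈ segment ℝ a b) : ‖t‖ ≤ c := by
  have := (convex_closedBall (0 : ℂ) c).segment_subset (x := a) (y := b) (by simpa) (by simpa) ht
  simpa using this

section Primitive

variable {g : ℂ → ℂ} {ξ : ℝ}

theorem intervalIntegrable_ray (hg : Continuous g) (hξ1 : ξ < 1) {u : ℂ} (hu : 0 < u.re)
    {a b : ℝ} (ha : 0 ≤ a) (hb : 0 ≤ b) :
    IntervalIntegrable (fun r : ℝ => g (r * u) * (r * u : ℂ) ^ (-(ξ : ℂ)) * u) volume a b := by
  have h0 : IntervalIntegrable (fun r : ℝ => r ^ (-ξ)) volume a b :=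
    intervalIntegral.intervalIntegrable_rpow' (by linarith)
  have h1 : IntervalIntegrable (fun r : ℝ => ((r ^ (-ξ) : ℝ) : ℂ)) volume a b :=
    ⟨h0.1.ofReal, h0.2.ofReal⟩
  have h2 := h1.continuousOn_mul
    (g := fun r : ℝ => g (r * u) * (u ^ (-(ξ : ℂ)) * u)) (by fun_prop)
  refine h2.congr (fun r hr => ?_)
  have hr0 : 0 < r := by
    rcases le_total a b with h | h
    · rw [uIoc_of_le h] at hr; exact ha.trans_lt hr.1
    · rw [uIoc_of_ge h] at hr; exact hb.trans_lt hr.1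
  rw [ofReal_mul_cpow hr0 (ne_zero_of_re_pos hu)]
  ring

/-- A holomorphic multiple of the principal branch of `t ^ (-ξ)` with `ξ < 1` has a primitive on
the right half-plane which vanishes at the boundary point `0`. -/
theorem exists_primitive_mul_cpow (hg : Differentiable ℂ g) (hξ0 : 0 ≤ ξ) (hξ1 : ξ < 1) :
    ∃ F : ℂ → ℂ, (∀ t : ℂ, 0 < t.re → HasDerivAt F (g t * t ^ (-(ξ : ℂ))) t) ∧
      ∀ u : ℂ, 0 < u.re → Tendsto (fun r : ℝ => F (r * u)) (𝓝[>] 0) (𝓝 0) := by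
  have hopen : IsOpen {t : ℂ | 0 < t.re} := isOpen_lt continuous_const Complex.continuous_re
  have hdiff : DifferentiableOn ℂ (fun t : ℂ => g t * t ^ (-(ξ : ℂ))) {t : ℂ | 0 < t.re} := by
    intro t ht
    have : t ∈ Complex.slitPlane := Or.inl ht
    exact ((hg t).mul (differentiableAt_id.cpow_const this)).differentiableWithinAt
  obtain ⟨F₀, hF₀⟩ := (convex_halfSpace_re_gt 0).exists_forall_hasDerivWithinAt hdiff
  have hF : ∀ t : ℂ, 0 < t.re → HasDerivAt F₀ (g t * t ^ (-(ξ : ℂ))) t := fun t ht =>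
    (hF₀ t ht).hasDerivAt (hopen.mem_nhds ht)
  -- the limit at `0` along the positive axis
  have hone : ∃ l : ℂ, Tendsto (fun r : ℝ => F₀ r) (𝓝[>] 0) (𝓝 l) := by
    set f : ℝ → ℂ := fun r => g r * (r : ℂ) ^ (-(ξ : ℂ)) with hf
    have hint : IntervalIntegrable f volume 0 1 := by
      simpa using intervalIntegrable_ray (g := g) (u := 1) hg.continuous hξ1 (by simp) le_rfl
        zero_le_one
    have hcont := intervalIntegral.continuousOn_primitive_interval' hint
      (right_mem_uIcc : (1 : ℝ) ∈ uIcc (0 : ℝ) 1)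
    have h0 := (hcont 0 left_mem_uIcc).tendsto
    rw [uIcc_of_le zero_le_one] at h0
    have h0' := h0.mono_left
      (nhdsWithin_mono 0 (Ioc_subset_Icc_self : Ioc (0 : ℝ) 1 ⊆ Icc 0 1))
    rw [nhdsWithin_Ioc_eq_nhdsGT one_pos] at h0'
    refine ⟨_, (h0'.const_add (F₀ 1)).congr' ?_⟩
    filter_upwards [Ioc_mem_nhdsGT one_pos] with x hx
    have := intervalIntegral.integral_eq_sub_of_hasDerivAt (f := fun r : ℝ => F₀ r) (f' := f)
      (a := 1) (b := x) ?_ ?_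
    · rw [this]; simp
    · intro r hr
      rw [uIcc_of_ge hx.2] at hr
      exact (hF r (by simpa using hx.1.trans_le hr.1)).comp_ofReal
    · exact (hint.mono_set (by rw [uIcc_of_ge hx.2, uIcc_of_le zero_le_one]
                               exact Icc_subset_Icc_left hx.1.le))
  obtain ⟨l, hl⟩ := hone
  refine ⟨fun t => F₀ t - l, fun t ht => (hF t ht).sub_const l, fun u hu => ?_⟩
  -- along another ray, compare by the segment joining `r` to `r u`
  obtain ⟨C, hC⟩ := (isCompact_closedBall (0 : ℂ) (‖u‖ + 1)).exists_bound_of_continuousOn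
    hg.continuous.continuousOn
  set m := min u.re 1 with hm
  have hm0 : 0 < m := lt_min hu one_pos
  have hdiff0 : Tendsto (fun r : ℝ => F₀ (r * u) - F₀ r) (𝓝[>] 0) (𝓝 0) := by
    have hpow : Tendsto (fun r : ℝ => r ^ (1 - ξ)) (𝓝[>] 0) (𝓝 0) := by
      have := (Real.continuousAt_rpow_const 0 (1 - ξ) (Or.inr (by linarith))).tendsto
      rw [Real.zero_rpow (by linarith)] at this
      exact this.mono_left nhdsWithin_le_nhds
    have hb := hpow.const_mul (C * m ^ (-ξ) * ‖u - 1‖)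
    rw [mul_zero] at hb
    refine squeeze_zero_norm' ?_ hb
    filter_upwards [Ioc_mem_nhdsGT one_pos] with r hr
    have hr0 : 0 < r := hr.1
    have hseg1 : ∀ t ∈ segment ℝ (r : ℂ) (r * u), r * m ≤ t.re := fun t ht => by
      refine le_re_of_mem_segment ?_ ?_ ht
      · simpa using mul_le_mul_of_nonneg_left (min_le_right u.re 1) hr0.le
      · simpa using mul_le_mul_of_nonneg_left (min_le_left u.re 1) hr0.le
    have hseg2 : ∀ t ∈ segment ℝ (r : ℂ) (r * u), ‖t‖ ≤ ‖u‖ + 1 := fun t ht => by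
      refine norm_le_of_mem_segment ?_ ?_ ht
      · rw [Complex.norm_real, Real.norm_of_nonneg hr0.le]
        linarith [norm_nonneg u, hr.2]
      · rw [norm_mul, Complex.norm_real, Real.norm_of_nonneg hr0.le]
        nlinarith [norm_nonneg u, hr.2]
    have hC0 : 0 ≤ C := (norm_nonneg _).trans (hC 0 (by simp; positivity))
    have key := norm_sub_le_of_forall_segment (F := F₀)
      (f := fun t => g t * t ^ (-(ξ : ℂ))) (a := (r : ℂ)) (b := r * u) (C := C * (r * m) ^ (-ξ))
      (fun t ht => hF t ((mul_pos hr0 hm0).trans_le (hseg1 t ht)))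
      (fun t ht => by
        rw [norm_mul]
        exact mul_le_mul (hC t (by simpa using hseg2 t ht))
          (norm_cpow_neg_le hξ0 (mul_pos hr0 hm0) (hseg1 t ht)) (norm_nonneg _) hC0)
    refine key.trans (le_of_eq ?_)
    have : (r : ℂ) * u - r = r * (u - 1) := by ring
    rw [this, norm_mul, Complex.norm_real, Real.norm_of_nonneg hr0.le,
      Real.mul_rpow hr0.le hm0.le, sub_eq_add_neg 1 ξ, Real.rpow_add hr0, Real.rpow_one]
    ring
  have := hdiff0.add (hl.sub_const l)
  simp only [sub_self, add_zero] at this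
  refine this.congr fun r => by ring

/-- The primitive normalised at `0` is the integral along any ray of the right half-plane. -/
theorem integral_ray (hg : Continuous g) (hξ1 : ξ < 1) {F : ℂ → ℂ}
    (hF : ∀ t : ℂ, 0 < t.re → HasDerivAt F (g t * t ^ (-(ξ : ℂ))) t) {u : ℂ} (hu : 0 < u.re)
    (hF0 : Tendsto (fun r : ℝ => F (r * u)) (𝓝[>] 0) (𝓝 0)) {R : ℝ} (hR : 0 < R) :
    ∫ r in (0 : ℝ)..R, g (r * u) * (r * u : ℂ) ^ (-(ξ : ℂ)) * u = F (R * u) := by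
  have hd : ∀ r : ℝ, 0 < r → HasDerivAt (fun r : ℝ => F (r * u))
      (g (r * u) * (r * u : ℂ) ^ (-(ξ : ℂ)) * u) r := fun r hr => by
    have h1 : HasDerivAt (fun r : ℂ => r * u) u (r : ℂ) := by
      simpa using (hasDerivAt_id (r : ℂ)).mul_const u
    exact ((hF (r * u) (by simpa using mul_pos hr hu)).comp (r : ℂ) h1).comp_ofReal
  have := intervalIntegral.integral_eq_sub_of_hasDerivAt_of_tendsto hR
    (fun r hr => hd r hr.1) (intervalIntegrable_ray hg hξ1 hu le_rfl hR.le) hF0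
    ((hd R hR).continuousAt.tendsto.mono_left nhdsWithin_le_nhds)
  rw [this, sub_zero]

/-- A primitive of `g(t) t ^ (-ξ)` vanishing at `0` tends at infinity, along a ray on which the
function is integrable, to the integral over that ray. -/
theorem tendsto_primitive_ray (hg : Continuous g) (hξ1 : ξ < 1) {F : ℂ → ℂ}
    (hF : ∀ t : ℂ, 0 < t.re → HasDerivAt F (g t * t ^ (-(ξ : ℂ))) t) {u : ℂ} (hu : 0 < u.re)
    (hF0 : Tendsto (fun r : ℝ => F (r * u)) (𝓝[>] 0) (𝓝 0))
    (hint : IntegrableOn (fun r : ℝ => g (r * u) * (r * u : ℂ) ^ (-(ξ : ℂ)) * u) (Ioi 0)) :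
    Tendsto (fun R : ℝ => F (R * u)) atTop
      (𝓝 (∫ r in Ioi (0 : ℝ), g (r * u) * (r * u : ℂ) ^ (-(ξ : ℂ)) * u)) := by
  refine (intervalIntegral_tendsto_integral_Ioi 0 hint tendsto_id).congr' ?_
  filter_upwards [eventually_gt_atTop 0] with R hR
  exact integral_ray hg hξ1 hF hu hF0 hR

end Primitive

theorem cexp_mul_I_cpow {φ : ℝ} (h1 : -Real.pi < φ) (h2 : φ ≤ Real.pi) (ξ : ℝ) :
    (Complex.exp (φ * Complex.I)) ^ (-(ξ : ℂ)) = Complex.exp (-(ξ * φ : ℝ) * Complex.I) := by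
  rw [Complex.cpow_def_of_ne_zero (Complex.exp_ne_zero _), Complex.log_exp (by simpa) (by simpa)]
  push_cast
  ring_nf

/-- The Gamma integral along a ray of the right half-plane. -/
theorem integral_exp_neg_mul_rpow {ξ : ℝ} (hξ0 : 0 ≤ ξ) (hξ1 : ξ < 1) {v : ℂ} (hv : 0 < v.re) :
    (∫ r in Ioi (0 : ℝ), Complex.exp (-v * r) * ((r ^ (-ξ) : ℝ) : ℂ)) * (v ^ (-(ξ : ℂ)) * v) =
      Real.Gamma (1 - ξ) := by
  obtain ⟨F, hF, hF0⟩ := exists_primitive_mul_cpow (g := fun t => Complex.exp (-t)) (ξ := ξ)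
    (by fun_prop) hξ0 hξ1
  have hcont : Continuous fun t : ℂ => Complex.exp (-t) := by fun_prop
  have hint : ∀ u : ℂ, 0 < u.re → IntegrableOn (fun r : ℝ =>
      Complex.exp (-(r * u)) * (r * u : ℂ) ^ (-(ξ : ℂ)) * u) (Ioi 0) := fun u hu => by
    have h := (integrableOn_rpow_mul_exp_neg_mul_rpow (by linarith : -1 < -ξ) one_pos
      hu).const_mul (‖u ^ (-(ξ : ℂ))‖ * ‖u‖)
    refine Integrable.mono' h ?_ ?_
    · apply Measurable.aestronglyMeasurable; fun_prop
    · filter_upwards [ae_restrict_mem measurableSet_Ioi] with r hr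
      have hr : 0 < r := hr
      rw [ofReal_mul_cpow hr (ne_zero_of_re_pos hu)]
      simp only [norm_mul, Complex.norm_exp, Complex.norm_real, Real.norm_of_nonneg
        (Real.rpow_nonneg hr.le (-ξ)), Real.rpow_one]
      have : (-((r : ℂ) * u)).re = -u.re * r := by simp; ring
      rw [this]
      exact le_of_eq (by ring)
  have T := fun u hu => tendsto_primitive_ray hcont hξ1 hF hu (hF0 u hu) (hint u hu)
  set m := min v.re 1 with hm
  have hm0 : 0 < m := lt_min hv one_pos
  have hzero : Tendsto (fun R : ℝ => F (R * v) - F (R * 1)) atTop (𝓝 0) := by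
    have h1 := (Real.tendsto_pow_mul_exp_neg_atTop_nhds_zero 1).comp
      (tendsto_id.const_mul_atTop hm0)
    have h2 := h1.const_mul (m ^ (-ξ) * ‖v - 1‖ / m)
    rw [mul_zero] at h2
    refine squeeze_zero_norm' ?_ h2
    filter_upwards [eventually_ge_atTop 1] with R hR
    have hR0 : 0 < R := by linarith
    have hseg : ∀ t ∈ segment ℝ ((R : ℂ) * 1) (R * v), R * m ≤ t.re := fun t ht => by
      refine le_re_of_mem_segment ?_ ?_ ht
      · simpa using mul_le_mul_of_nonneg_left (min_le_right v.re 1) hR0.le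
      · simpa using mul_le_mul_of_nonneg_left (min_le_left v.re 1) hR0.le
    have key := norm_sub_le_of_forall_segment (F := F)
      (f := fun t => Complex.exp (-t) * t ^ (-(ξ : ℂ))) (a := (R : ℂ) * 1) (b := R * v)
      (C := Real.exp (-(R * m)) * m ^ (-ξ))
      (fun t ht => hF t ((mul_pos hR0 hm0).trans_le (hseg t ht)))
      (fun t ht => by
        rw [norm_mul, Complex.norm_exp]
        have h3 := hseg t ht
        refine mul_le_mul (Real.exp_le_exp.2 (by simpa using h3))
          (norm_cpow_neg_le hξ0 hm0 (le_trans ?_ h3)) (norm_nonneg _) (Real.exp_nonneg _)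
        nlinarith)
    refine key.trans (le_of_eq ?_)
    have : (R : ℂ) * v - R * 1 = R * (v - 1) := by ring
    rw [this, norm_mul, Complex.norm_real, Real.norm_of_nonneg hR0.le]
    simp only [Function.comp_apply, pow_one, id_eq]
    rw [mul_comm m R]
    field_simp
  have heq := tendsto_nhds_unique hzero ((T v hv).sub (T 1 (by simp)))
  have e1 : ∫ r in Ioi (0 : ℝ), Complex.exp (-((r : ℂ) * v)) * (r * v : ℂ) ^ (-(ξ : ℂ)) * v =
      (∫ r in Ioi (0 : ℝ), Complex.exp (-v * r) * ((r ^ (-ξ) : ℝ) : ℂ)) *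
        (v ^ (-(ξ : ℂ)) * v) := by
    rw [← integral_mul_const]
    refine setIntegral_congr_fun measurableSet_Ioi fun r hr => ?_
    rw [ofReal_mul_cpow hr (ne_zero_of_re_pos hv)]
    ring_nf
  have e2 : ∫ r in Ioi (0 : ℝ), Complex.exp (-((r : ℂ) * 1)) * (r * 1 : ℂ) ^ (-(ξ : ℂ)) * 1 =
      Real.Gamma (1 - ξ) := by
    rw [Real.Gamma_eq_integral (by linarith), ← integral_complex_ofReal]
    refine setIntegral_congr_fun measurableSet_Ioi fun r hr => ?_
    have hr : 0 < r := hr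
    simp only [mul_one]
    rw [show 1 - ξ - 1 = -ξ by ring]
    push_cast [Complex.ofReal_cpow hr.le]
    ring_nf
  rw [e1, e2] at heq
  exact (sub_eq_zero.1 heq.symm)

end

/-! ### Limits of the primitive at infinity -/

noncomputable section

/-- The entire factor `exp(t³/3 - z t)` of the contour integrals representing solutions. -/
def airyExp (z t : ℂ) : ℂ := Complex.exp (t ^ 3 / 3 - z * t)

theorem differentiable_airyExp (z : ℂ) : Differentiable ℂ (airyExp z) := by
  unfold airyExp; fun_prop

/-- The sixth root of unity `exp(± iπ/3)`, the sign being `σ`; its cube is `-1`. -/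
def rootU (σ : ℝ) : ℂ := ⟨1 / 2, σ * (√3 / 2)⟩

theorem rootU_pow_three {σ : ℝ} (hσ : σ ^ 2 = 1) : rootU σ ^ 3 = -1 := by
  have h3 : √3 ^ 2 = 3 := Real.sq_sqrt (by norm_num)
  have e : rootU σ ^ 3 = rootU σ * rootU σ * rootU σ := by ring
  rw [e]
  apply Complex.ext
  · simp [rootU]
    linear_combination (-3 / 8) * σ ^ 2 * h3 - (9 / 8) * hσ
  · simp [rootU]
    linear_combination (-σ * √3 / 8) * σ ^ 2 * h3 + (-3 / 8 * σ * √3) * hσ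

theorem rootU_re (σ : ℝ) : (rootU σ).re = 1 / 2 := rfl

theorem norm_airyExp (z : ℂ) (x y : ℝ) :
    ‖airyExp z (x + y * Complex.I)‖ =
      Real.exp ((x ^ 3 - 3 * x * y ^ 2) / 3 - (z * (x + y * Complex.I)).re) := by
  rw [airyExp, Complex.norm_exp]
  congr 1
  rw [Complex.sub_re]
  congr 1
  have : ((x : ℂ) + y * Complex.I) ^ 3 / 3 =
      (((x ^ 3 - 3 * x * y ^ 2) / 3 : ℝ) : ℂ) + (((3 * x ^ 2 * y - y ^ 3) / 3 : ℝ) : ℂ) *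
        Complex.I := by
    push_cast
    linear_combination ((x : ℂ) * y ^ 2 + y ^ 3 * Complex.I / 3) * Complex.I_sq
  rw [this, Complex.add_re, Complex.re_ofReal_mul, Complex.I_re, Complex.ofReal_re, mul_zero,
    add_zero]

variable {ξ : ℝ} {z : ℂ} {F : ℂ → ℂ}

theorem airyExp_cubeRay {u : ℂ} (hu : u ^ 3 = -1) (hu0 : u ≠ 0) {r : ℝ} (hr : 0 < r) :
    airyExp z (r * u) * (r * u : ℂ) ^ (-(ξ : ℂ)) * u =
      Complex.exp (-(r : ℂ) ^ 3 / 3 + -(z * u) * r) * ((r ^ (-ξ) : ℝ) : ℂ) *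
        (u ^ (-(ξ : ℂ)) * u) := by
  rw [ofReal_mul_cpow hr hu0, airyExp]
  have : ((r : ℂ) * u) ^ 3 / 3 - z * (r * u) = -(r : ℂ) ^ 3 / 3 + -(z * u) * r := by
    linear_combination (r : ℂ) ^ 3 / 3 * hu
  rw [this]; ring

/-- Along a ray in the direction of a cube root of `-1` the primitive of the kernel tends to a
multiple of a rotated `airyMoment`. -/
theorem tendsto_primitive_cubeRay (hξ1 : ξ < 1)
    (hF : ∀ t : ℂ, 0 < t.re → HasDerivAt F (airyExp z t * t ^ (-(ξ : ℂ))) t)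
    (hF0 : ∀ u : ℂ, 0 < u.re → Tendsto (fun r : ℝ => F (r * u)) (𝓝[>] 0) (𝓝 0))
    {u : ℂ} (hu : u ^ 3 = -1) (hre : 0 < u.re) :
    Tendsto (fun R : ℝ => F (R * u)) atTop
      (𝓝 (u ^ (-(ξ : ℂ)) * u * airyMoment (-ξ) (-(z * u)))) := by
  have hu0 := ne_zero_of_re_pos hre
  have hint : IntegrableOn (fun r : ℝ => airyExp z (r * u) * (r * u : ℂ) ^ (-(ξ : ℂ)) * u)
      (Ioi 0) := by
    refine IntegrableOn.congr_fun ((integrableOn_airyMoment (by linarith : -1 < -ξ)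
      (-(z * u))).mul_const (u ^ (-(ξ : ℂ)) * u)) (fun r hr => ?_) measurableSet_Ioi
    exact (airyExp_cubeRay hu hu0 hr).symm
  have key := tendsto_primitive_ray (differentiable_airyExp z).continuous hξ1 hF hre
    (hF0 u hre) hint
  have e : ∫ r in Ioi (0 : ℝ), airyExp z (r * u) * (r * u : ℂ) ^ (-(ξ : ℂ)) * u =
      u ^ (-(ξ : ℂ)) * u * airyMoment (-ξ) (-(z * u)) := by
    rw [airyMoment, mul_comm, ← integral_mul_const]
    exact setIntegral_congr_fun measurableSet_Ioi fun r hr => airyExp_cubeRay hu hu0 hr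
  rwa [e] at key

theorem exists_of_mem_segment_horizontal {a b y : ℝ} (hab : a ≤ b) {t : ℂ}
    (ht : t ∈ segment ℝ ((a : ℂ) + y * Complex.I) ((b : ℂ) + y * Complex.I)) :
    ∃ x : ℝ, a ≤ x ∧ x ≤ b ∧ t = x + y * Complex.I := by
  obtain ⟨p, q, hp, hq, hpq, rfl⟩ := ht
  obtain rfl : p = 1 - q := by linarith
  refine ⟨(1 - q) * a + q * b, ?_, ?_, ?_⟩
  · nlinarith [mul_le_mul_of_nonneg_left hab hq]
  · nlinarith [mul_le_mul_of_nonneg_left hab hp]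
  · simp only [Complex.real_smul]
    push_cast
    ring

/-- The primitive has the same limit at the ends of a vertical line as along the neighbouring
ray in the direction of a cube root of `-1`: the two are joined by horizontal segments on which
the kernel is exponentially small. -/
theorem tendsto_primitive_vertical (hξ0 : 0 ≤ ξ) (hξ1 : ξ < 1)
    (hF : ∀ t : ℂ, 0 < t.re → HasDerivAt F (airyExp z t * t ^ (-(ξ : ℂ))) t)
    (hF0 : ∀ u : ℂ, 0 < u.re → Tendsto (fun r : ℝ => F (r * u)) (𝓝[>] 0) (𝓝 0))
    {σ : ℝ} (hσ : σ ^ 2 = 1) {c : ℝ} (hc : 0 < c) :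
    Tendsto (fun w : ℝ => F (c + (σ * √3 * w : ℝ) * Complex.I)) atTop
      (𝓝 (rootU σ ^ (-(ξ : ℂ)) * rootU σ * airyMoment (-ξ) (-(z * rootU σ)))) := by
  have h1 := (tendsto_primitive_cubeRay hξ1 hF hF0 (rootU_pow_three hσ)
    (by rw [rootU_re]; norm_num)).comp (tendsto_id.const_mul_atTop (two_pos : (0 : ℝ) < 2))
  have h3 : √3 ^ 2 = 3 := Real.sq_sqrt (by norm_num)
  have hs3 : 0 ≤ √3 := Real.sqrt_nonneg 3
  have hs2 : √3 ≤ 2 := by nlinarith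
  -- at height `σ √3 w` the ray passes through `2 w * rootU σ = w + σ √3 w i`
  suffices hz : Tendsto (fun w : ℝ => F (c + (σ * √3 * w : ℝ) * Complex.I) -
      F (w + (σ * √3 * w : ℝ) * Complex.I)) atTop (𝓝 0) by
    have := hz.add h1
    rw [zero_add] at this
    refine this.congr fun w => ?_
    have e : ((2 * w : ℝ) : ℂ) * rootU σ = w + (σ * √3 * w : ℝ) * Complex.I := by
      apply Complex.ext
      · simp [rootU]; ring
      · simp [rootU]; ring
    simp only [Function.comp_apply, id_eq, e, sub_add_cancel]
  have hb := (Real.tendsto_pow_mul_exp_neg_atTop_nhds_zero 1).const_mul (c ^ (-ξ))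
  rw [mul_zero] at hb
  refine squeeze_zero_norm' ?_ hb
  filter_upwards [eventually_ge_atTop c, eventually_ge_atTop ((3 * ‖z‖ + 1) / c),
    eventually_ge_atTop 0] with w hw1 hw2 hw0
  have hsq : (σ * √3 * w) ^ 2 = 3 * w ^ 2 := by
    linear_combination (√3 ^ 2 * w ^ 2) * hσ + w ^ 2 * h3
  have hw3 : 3 * ‖z‖ + 1 ≤ w * c := (div_le_iff₀ hc).1 hw2
  have key := norm_sub_le_of_forall_segment (F := F)
    (f := fun t => airyExp z t * t ^ (-(ξ : ℂ)))
    (a := c + (σ * √3 * w : ℝ) * Complex.I) (b := w + (σ * √3 * w : ℝ) * Complex.I)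
    (C := Real.exp (-w) * c ^ (-ξ)) ?_ ?_
  · rw [norm_sub_rev]
    refine key.trans ?_
    have e : (w : ℂ) + (σ * √3 * w : ℝ) * Complex.I - (c + (σ * √3 * w : ℝ) * Complex.I) =
        ((w - c : ℝ) : ℂ) := by push_cast; ring
    rw [e, Complex.norm_real, Real.norm_of_nonneg (by linarith), pow_one]
    have : 0 ≤ Real.exp (-w) * c ^ (-ξ) := by positivity
    nlinarith
  · intro t ht
    obtain ⟨x, hx1, hx2, rfl⟩ := exists_of_mem_segment_horizontal hw1 ht
    exact hF _ (by simp; linarith)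
  · intro t ht
    obtain ⟨x, hx1, hx2, rfl⟩ := exists_of_mem_segment_horizontal hw1 ht
    rw [norm_mul, norm_airyExp, hsq]
    refine mul_le_mul (Real.exp_le_exp.2 ?_) (norm_cpow_neg_le hξ0 hc (by simpa using hx1))
      (norm_nonneg _) (Real.exp_nonneg _)
    have hre : -(z * ((x : ℂ) + (σ * √3 * w : ℝ) * Complex.I)).re ≤ ‖z‖ * (3 * w) := by
      refine (neg_le_abs _).trans ((Complex.abs_re_le_norm _).trans ?_)
      rw [norm_mul]
      refine mul_le_mul_of_nonneg_left ?_ (norm_nonneg z)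
      refine (norm_add_le _ _).trans ?_
      rw [norm_mul, Complex.norm_I, Complex.norm_real, Complex.norm_real,
        Real.norm_of_nonneg (by linarith : 0 ≤ x), Real.norm_eq_abs, mul_one]
      have : |σ * √3 * w| ≤ 2 * w := abs_le_of_sq_le_sq (by nlinarith) (by linarith)
      linarith
    have hx3 : x ^ 3 ≤ x * w ^ 2 := by
      have : x ^ 2 ≤ w ^ 2 := by nlinarith
      nlinarith
    have hx4 : c * w ^ 2 ≤ x * w ^ 2 := by gcongr
    nlinarith [mul_le_mul_of_nonneg_left hw3 hw0]

/-- On the boundary ray `arg t = π/6` of the sector of decay, where the kernel with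
`z = θ exp(-2πi/3)` only oscillates, the primitive still has the limit it has on the central ray
`arg t = π/3`. -/
theorem tendsto_primitive_boundary (hξ0 : 0 ≤ ξ) (hξ1 : ξ < 1) (θ : ℝ)
    (hz : z = θ * (-1 / 2 - √3 / 2 * Complex.I))
    (hF : ∀ t : ℂ, 0 < t.re → HasDerivAt F (airyExp z t * t ^ (-(ξ : ℂ))) t)
    (hF0 : ∀ u : ℂ, 0 < u.re → Tendsto (fun r : ℝ => F (r * u)) (𝓝[>] 0) (𝓝 0)) :
    Tendsto (fun w : ℝ => F (3 * w + (√3 * w : ℝ) * Complex.I)) atTop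
      (𝓝 (rootU 1 ^ (-(ξ : ℂ)) * rootU 1 * airyMoment (-ξ) (-(z * rootU 1)))) := by
  have h1 := (tendsto_primitive_cubeRay hξ1 hF hF0 (rootU_pow_three (one_pow 2))
    (by rw [rootU_re]; norm_num)).comp (tendsto_id.const_mul_atTop (two_pos : (0 : ℝ) < 2))
  have h3 : √3 ^ 2 = 3 := Real.sq_sqrt (by norm_num)
  suffices hz : Tendsto (fun w : ℝ => F (3 * w + (√3 * w : ℝ) * Complex.I) -
      F (w + (√3 * w : ℝ) * Complex.I)) atTop (𝓝 0) by
    have := hz.add h1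
    rw [zero_add] at this
    refine this.congr fun w => ?_
    have e : ((2 * w : ℝ) : ℂ) * rootU 1 = w + (√3 * w : ℝ) * Complex.I := by
      apply Complex.ext
      · simp [rootU]; ring
      · simp [rootU]; ring
    simp only [Function.comp_apply, id_eq, e, sub_add_cancel]
  have hb : Tendsto (fun w : ℝ => (w ^ 2)⁻¹) atTop (𝓝 0) :=
    tendsto_inv_atTop_zero.comp (tendsto_pow_atTop two_ne_zero)
  refine squeeze_zero_norm' ?_ hb
  filter_upwards [eventually_ge_atTop 1, eventually_ge_atTop (3 * |θ|)] with w hw1 hw2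
  have hw0 : 0 < w := by linarith
  -- at distance `s` from the right end of the horizontal segment the kernel is at most
  -- `exp(-w² s)`, so that the variation of the primitive is at most `w⁻²`
  set φ : ℝ → ℂ := fun s => F (((3 * w - s : ℝ) : ℂ) + (√3 * w : ℝ) * Complex.I) -
    F (3 * w + (√3 * w : ℝ) * Complex.I) with hφ
  set k : ℝ → ℂ := fun s => -(airyExp z (((3 * w - s : ℝ) : ℂ) + (√3 * w : ℝ) * Complex.I) *
    (((3 * w - s : ℝ) : ℂ) + (√3 * w : ℝ) * Complex.I) ^ (-(ξ : ℂ))) with hk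
  have hd : ∀ s : ℝ, s ≤ 2 * w → HasDerivAt φ (k s) s := fun s hs => by
    have h2 : HasDerivAt (fun s : ℝ => ((3 * w - s : ℝ) : ℂ) + (√3 * w : ℝ) * Complex.I)
        (-1) s := by
      have := ((((hasDerivAt_id s).const_sub (3 * w)).ofReal_comp).add_const
        (((√3 * w : ℝ) : ℂ) * Complex.I))
      simpa using this
    have h4 := hF (((3 * w - s : ℝ) : ℂ) + (√3 * w : ℝ) * Complex.I) (by simp; linarith)
    have := (h4.scomp s h2).sub_const (F (3 * w + (√3 * w : ℝ) * Complex.I))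
    simpa [hφ, hk, Function.comp_def] using this
  have key := image_norm_le_of_norm_deriv_right_le_deriv_boundary (f := φ) (f' := k)
    (a := 0) (b := 2 * w) (B := fun s => (w ^ 2)⁻¹ * (1 - Real.exp (-(w ^ 2) * s)))
    (B' := fun s => Real.exp (-(w ^ 2) * s))
    (fun s hs => (hd s hs.2).continuousAt.continuousWithinAt)
    (fun s hs => (hd s hs.2.le).hasDerivWithinAt) (by simp [hφ]) ?_ ?_
    (x := 2 * w) ⟨by linarith, le_rfl⟩
  · rw [norm_sub_rev]
    have e : ((3 * w - 2 * w : ℝ) : ℂ) = (w : ℂ) := by push_cast; ring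
    simp only [hφ, e] at key
    refine key.trans ?_
    have : 0 ≤ (w ^ 2)⁻¹ := by positivity
    nlinarith [Real.exp_pos (-(w ^ 2) * (2 * w))]
  · intro s
    have := (((hasDerivAt_id s).const_mul (-(w ^ 2))).exp.const_sub 1).const_mul ((w ^ 2)⁻¹)
    convert! this using 1
    have : w ^ 2 ≠ 0 := by positivity
    simp only [id_eq]
    field_simp
  · intro s hs
    have hx : w ≤ 3 * w - s := by linarith [hs.2]
    have hs0 : 0 ≤ s := hs.1
    simp only [hk, norm_neg, norm_mul]
    rw [norm_airyExp]
    have hp : ‖(((3 * w - s : ℝ) : ℂ) + (√3 * w : ℝ) * Complex.I) ^ (-(ξ : ℂ))‖ ≤ 1 := by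
      have := norm_cpow_neg_le hξ0 one_pos
        (t := ((3 * w - s : ℝ) : ℂ) + (√3 * w : ℝ) * Complex.I) (by simp; linarith)
      simpa using this
    refine (mul_le_of_le_one_right (Real.exp_nonneg _) hp).trans (Real.exp_le_exp.2 ?_)
    have hre : (z * (((3 * w - s : ℝ) : ℂ) + (√3 * w : ℝ) * Complex.I)).re = θ * (s / 2) := by
      rw [hz]
      simp
      linear_combination (θ * w / 2) * h3
    have h5 : (√3 * w) ^ 2 = 3 * w ^ 2 := by linear_combination w ^ 2 * h3
    rw [hre, h5]
    have h6 : -θ ≤ |θ| := neg_le_abs θ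
    have h7 : 4 * w ^ 2 ≤ (3 * w - s) * (3 * w + (3 * w - s)) := by nlinarith
    have h8 := mul_le_mul_of_nonneg_left h7 hs0
    have h9 : -θ * s ≤ w / 3 * s := mul_le_mul_of_nonneg_right (by linarith) hs0
    have h10 : w * s ≤ w ^ 2 * s := mul_le_mul_of_nonneg_right (by nlinarith) hs0
    nlinarith

end

/-! ### Rotation of the contour and the saddle point integral -/

noncomputable section

variable {ξ : ℝ}

/-- The cube root of unity `exp(2πi/3)`. -/
def cubeRoot : ℂ := ⟨-1 / 2, √3 / 2⟩

theorem cubeRoot_eq : cubeRoot = -1 / 2 + √3 / 2 * Complex.I := by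
  apply Complex.ext <;> simp [cubeRoot]

theorem rootU_eq (σ : ℝ) : rootU σ = 1 / 2 + σ * (√3 / 2) * Complex.I := by
  apply Complex.ext <;> simp [rootU]

theorem ofReal_sqrt_three_sq : ((√3 : ℝ) : ℂ) ^ 2 = 3 := by
  rw [← Complex.ofReal_pow, Real.sq_sqrt (by norm_num)]; norm_num

theorem cubeRoot_pow_three : cubeRoot ^ 3 = 1 := by
  rw [cubeRoot_eq]
  linear_combination (-3 * √3 ^ 2 / 8 + √3 ^ 3 / 8 * Complex.I) * Complex.I_sq +
    (3 / 8 - √3 / 8 * Complex.I) * ofReal_sqrt_three_sq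

theorem cexp_pi_div_three : Complex.exp ((Real.pi / 3 : ℝ) * Complex.I) = rootU 1 := by
  apply Complex.ext
  · rw [Complex.exp_ofReal_mul_I_re, Real.cos_pi_div_three, rootU_re]
  · rw [Complex.exp_ofReal_mul_I_im, Real.sin_pi_div_three]; simp [rootU]

theorem cexp_neg_pi_div_three : Complex.exp ((-(Real.pi / 3) : ℝ) * Complex.I) = rootU (-1) := by
  apply Complex.ext
  · rw [Complex.exp_ofReal_mul_I_re, Real.cos_neg, Real.cos_pi_div_three, rootU_re]
  · rw [Complex.exp_ofReal_mul_I_im, Real.sin_neg, Real.sin_pi_div_three]; simp [rootU]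

theorem cexp_pi_div_six :
    Complex.exp ((Real.pi / 6 : ℝ) * Complex.I) = √3 / 2 + 1 / 2 * Complex.I := by
  apply Complex.ext
  · rw [Complex.exp_ofReal_mul_I_re, Real.cos_pi_div_six]; simp
  · rw [Complex.exp_ofReal_mul_I_im, Real.sin_pi_div_six]; simp

theorem rootU_one_factor (ξ : ℝ) : rootU 1 ^ (-(ξ : ℂ)) * rootU 1 =
    Complex.exp ((Real.pi / 3 * (1 - ξ) : ℝ) * Complex.I) := by
  rw [← cexp_pi_div_three, cexp_mul_I_cpow (by linarith [Real.pi_pos]) (by linarith [Real.pi_pos]),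
    ← Complex.exp_add]
  congr 1; push_cast; ring

theorem rootU_neg_one_factor (ξ : ℝ) : rootU (-1) ^ (-(ξ : ℂ)) * rootU (-1) =
    Complex.exp ((-(Real.pi / 3 * (1 - ξ)) : ℝ) * Complex.I) := by
  rw [← cexp_neg_pi_div_three,
    cexp_mul_I_cpow (by linarith [Real.pi_pos]) (by linarith [Real.pi_pos]), ← Complex.exp_add]
  congr 1; push_cast; ring

theorem intervalIntegrable_oscillatory (hξ1 : ξ < 1) (θ R : ℝ) :
    IntervalIntegrable (fun τ : ℝ =>
      Complex.exp ((τ ^ 3 / 3 + θ * τ : ℝ) * Complex.I) * ((τ ^ (-ξ) : ℝ) : ℂ)) volume 0 R := by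
  have h0 : IntervalIntegrable (fun r : ℝ => r ^ (-ξ)) volume 0 R :=
    intervalIntegral.intervalIntegrable_rpow' (by linarith)
  have h1 : IntervalIntegrable (fun r : ℝ => ((r ^ (-ξ) : ℝ) : ℂ)) volume 0 R :=
    ⟨h0.1.ofReal, h0.2.ofReal⟩
  exact h1.continuousOn_mul (by fun_prop)

/-- Rotating the contour by `π/6` turns the oscillatory integral into an absolutely convergent
one, the moment of the cubic exponential at `exp(2πi/3) θ`. -/
theorem tendsto_oscillatory (hξ0 : 0 ≤ ξ) (hξ1 : ξ < 1) (θ : ℝ) :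
    Tendsto (fun R : ℝ => ∫ τ in (0 : ℝ)..R,
      Complex.exp ((τ ^ 3 / 3 + θ * τ : ℝ) * Complex.I) * ((τ ^ (-ξ) : ℝ) : ℂ)) atTop
      (𝓝 (Complex.exp ((Real.pi / 6 * (1 - ξ) : ℝ) * Complex.I) *
        airyMoment (-ξ) (cubeRoot * θ))) := by
  set z : ℂ := θ * (-1 / 2 - √3 / 2 * Complex.I) with hz
  set v : ℂ := √3 / 2 + 1 / 2 * Complex.I with hv
  have hI := Complex.I_sq
  have h3 := ofReal_sqrt_three_sq
  have hs3 : 0 < √3 := Real.sqrt_pos.2 (by norm_num)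
  have hvre : 0 < v.re := by simp [hv]
  have hv0 := ne_zero_of_re_pos hvre
  obtain ⟨F, hF, hF0⟩ := exists_primitive_mul_cpow (differentiable_airyExp z) hξ0 hξ1
  have hw := (tendsto_primitive_boundary hξ0 hξ1 θ hz hF hF0).comp
    (tendsto_id.atTop_div_const (by positivity : 0 < 2 * √3))
  have hvf : v ^ (-(ξ : ℂ)) * v = Complex.exp ((Real.pi / 6 * (1 - ξ) : ℝ) * Complex.I) := by
    rw [hv, ← cexp_pi_div_six,
      cexp_mul_I_cpow (by linarith [Real.pi_pos]) (by linarith [Real.pi_pos]), ← Complex.exp_add]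
    congr 1; push_cast; ring
  have harg : -(z * rootU 1) = cubeRoot * θ := by
    rw [hz, rootU_eq, cubeRoot_eq]
    push_cast
    linear_combination (θ * √3 ^ 2 / 4 : ℂ) * hI - (θ / 4 : ℂ) * h3
  have hlim : Complex.exp ((-(Real.pi / 6 * (1 - ξ)) : ℝ) * Complex.I) *
      (rootU 1 ^ (-(ξ : ℂ)) * rootU 1 * airyMoment (-ξ) (-(z * rootU 1))) =
      Complex.exp ((Real.pi / 6 * (1 - ξ) : ℝ) * Complex.I) *
        airyMoment (-ξ) (cubeRoot * θ) := by
    rw [harg, rootU_one_factor, ← mul_assoc, ← Complex.exp_add]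
    congr 2; push_cast; ring
  rw [← hlim]
  refine (hw.const_mul _).congr' ?_
  filter_upwards [eventually_gt_atTop 0] with R hR
  have hray := integral_ray (differentiable_airyExp z).continuous hξ1 hF hvre (hF0 v hvre) hR
  have e1 : ∫ r in (0 : ℝ)..R, airyExp z (r * v) * (r * v : ℂ) ^ (-(ξ : ℂ)) * v =
      (∫ τ in (0 : ℝ)..R, Complex.exp ((τ ^ 3 / 3 + θ * τ : ℝ) * Complex.I) *
        ((τ ^ (-ξ) : ℝ) : ℂ)) * (v ^ (-(ξ : ℂ)) * v) := by
    rw [← intervalIntegral.integral_mul_const]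
    refine intervalIntegral.integral_congr_ae (Eventually.of_forall fun r hr => ?_)
    rw [uIoc_of_le hR.le] at hr
    rw [ofReal_mul_cpow hr.1 hv0, airyExp]
    have : ((r : ℂ) * v) ^ 3 / 3 - z * (r * v) = (r ^ 3 / 3 + θ * r : ℝ) * Complex.I := by
      rw [hv, hz]
      push_cast
      linear_combination (r ^ 3 / 24 * (Complex.I + 3 * √3) + θ * r * √3 / 4 : ℂ) * hI +
        (r ^ 3 / 24 * (√3 + 3 * Complex.I) + θ * r / 4 * Complex.I : ℂ) * h3
    rw [this]; ring
  have e2 : 3 * ((R / (2 * √3) : ℝ) : ℂ) + (√3 * (R / (2 * √3)) : ℝ) * Complex.I = R * v := by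
    have h0 : ((√3 : ℝ) : ℂ) ≠ 0 := Complex.ofReal_ne_zero.2 hs3.ne'
    rw [hv]
    push_cast
    field_simp
    linear_combination -R * h3
  simp only [Function.comp_apply, id_eq]
  rw [e2, ← hray, e1, hvf, mul_left_comm, ← Complex.exp_add]
  have : ((-(Real.pi / 6 * (1 - ξ)) : ℝ) : ℂ) * Complex.I +
      (Real.pi / 6 * (1 - ξ) : ℝ) * Complex.I = 0 := by push_cast; ring
  rw [this, Complex.exp_zero, mul_one]

theorem hasImproperIntegral_cos (hξ0 : 0 ≤ ξ) (hξ1 : ξ < 1) (θ φ : ℝ) :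
    HasImproperIntegral (fun τ => Real.cos (τ ^ 3 / 3 + θ * τ + φ) * τ ^ (-ξ))
      (Complex.exp ((Real.pi / 6 * (1 - ξ) + φ : ℝ) * Complex.I) *
        airyMoment (-ξ) (cubeRoot * θ)).re := by
  have e : ∀ τ : ℝ, Real.cos (τ ^ 3 / 3 + θ * τ + φ) * τ ^ (-ξ) =
      Complex.reCLM (Complex.exp (φ * Complex.I) *
        (Complex.exp ((τ ^ 3 / 3 + θ * τ : ℝ) * Complex.I) * ((τ ^ (-ξ) : ℝ) : ℂ))) := by
    intro τ
    rw [← mul_assoc, ← Complex.exp_add, ← add_mul, ← Complex.ofReal_add, Complex.reCLM_apply,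
      Complex.re_mul_ofReal, Complex.exp_ofReal_mul_I_re, add_comm φ]
  have hint := fun R : ℝ => (intervalIntegrable_oscillatory hξ1 θ R).const_mul
    (Complex.exp (φ * Complex.I))
  have hmap : ∀ R : ℝ, ∫ τ in (0 : ℝ)..R, Real.cos (τ ^ 3 / 3 + θ * τ + φ) * τ ^ (-ξ) =
      Complex.reCLM (Complex.exp (φ * Complex.I) * ∫ τ in (0 : ℝ)..R,
        Complex.exp ((τ ^ 3 / 3 + θ * τ : ℝ) * Complex.I) * ((τ ^ (-ξ) : ℝ) : ℂ)) := fun R => by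
    simp_rw [e]
    rw [Complex.reCLM.intervalIntegral_comp_comm (hint R), intervalIntegral.integral_const_mul]
  refine ⟨fun R _ => ?_, ?_⟩
  · simp_rw [e]
    exact ⟨Complex.reCLM.integrable_comp (hint R).1, Complex.reCLM.integrable_comp (hint R).2⟩
  · simp_rw [hmap]
    have := (Complex.reCLM.continuous.tendsto _).comp
      ((tendsto_oscillatory hξ0 hξ1 θ).const_mul (Complex.exp (φ * Complex.I)))
    rw [← mul_assoc, ← Complex.exp_add, ← add_mul, ← Complex.ofReal_add, add_comm φ] at this
    exact this

theorem Lb_eq_re (hξ0 : 0 ≤ ξ) (hξ1 : ξ < 1) (θ : ℝ) :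
    Lb ξ θ = (Complex.exp ((Real.pi / 6 + ξ * Real.pi / 3 : ℝ) * Complex.I) *
      airyMoment (-ξ) (cubeRoot * θ)).re := by
  have := (hasImproperIntegral_cos hξ0 hξ1 θ (ξ * Real.pi / 2)).2.limUnder_eq
  rw [show Real.pi / 6 * (1 - ξ) + ξ * Real.pi / 2 = Real.pi / 6 + ξ * Real.pi / 3 by ring]
    at this
  exact this

theorem Lc_eq_re (hξ0 : 0 ≤ ξ) (hξ1 : ξ < 1) (θ : ℝ) :
    Lc ξ θ = (Complex.exp ((Real.pi / 6 - 2 * ξ * Real.pi / 3 : ℝ) * Complex.I) *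
      airyMoment (-ξ) (cubeRoot * θ)).re := by
  have := (hasImproperIntegral_cos hξ0 hξ1 θ (-(ξ * Real.pi / 2))).2.limUnder_eq
  rw [show Real.pi / 6 * (1 - ξ) + -(ξ * Real.pi / 2) = Real.pi / 6 - 2 * ξ * Real.pi / 3 by ring]
    at this
  exact this

theorem hasImproperIntegral_lbIntegrand (hξ0 : 0 ≤ ξ) (hξ1 : ξ < 1) (θ : ℝ) :
    HasImproperIntegral (lbIntegrand ξ θ) (Lb ξ θ) := by
  have h := hasImproperIntegral_cos hξ0 hξ1 θ (ξ * Real.pi / 2)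
  exact ⟨h.1, tendsto_nhds_limUnder ⟨_, h.2⟩⟩

theorem hasImproperIntegral_lcIntegrand (hξ0 : 0 ≤ ξ) (hξ1 : ξ < 1) (θ : ℝ) :
    HasImproperIntegral (lcIntegrand ξ θ) (Lc ξ θ) := by
  have h := hasImproperIntegral_cos hξ0 hξ1 θ (-(ξ * Real.pi / 2))
  exact ⟨h.1, tendsto_nhds_limUnder ⟨_, h.2⟩⟩

/-- The Gaussian-type integral along the vertical line through the saddle point `p` of
`t³/3 - p² t`, with the value of the exponential at the saddle taken out. -/
def saddleIntegral (ξ : ℝ) (p : ℂ) : ℂ :=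
  ∫ s : ℝ, Complex.exp (-p * s ^ 2 - Complex.I * s ^ 3 / 3) *
    (p + s * Complex.I) ^ (-(ξ : ℂ))

theorem norm_cexp_saddle (p : ℂ) (k s : ℝ) :
    ‖Complex.exp (-p * s ^ 2 - Complex.I * k * s ^ 3 / 3)‖ = Real.exp (-p.re * s ^ 2) := by
  rw [Complex.norm_exp]
  congr 1
  have : -p * (s : ℂ) ^ 2 - Complex.I * k * s ^ 3 / 3 =
      -p * ((s ^ 2 : ℝ) : ℂ) - ((k * s ^ 3 / 3 : ℝ) : ℂ) * Complex.I := by push_cast; ring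
  rw [this, Complex.sub_re, Complex.re_mul_ofReal, Complex.re_ofReal_mul]
  simp

theorem norm_saddle_integrand_le (hξ0 : 0 ≤ ξ) {p : ℂ} (hp : 0 < p.re) (k s : ℝ) :
    ‖Complex.exp (-p * s ^ 2 - Complex.I * k * s ^ 3 / 3) *
      (p + k * s * Complex.I) ^ (-(ξ : ℂ))‖ ≤ Real.exp (-p.re * s ^ 2) * p.re ^ (-ξ) := by
  rw [norm_mul, norm_cexp_saddle]
  gcongr
  refine norm_cpow_neg_le hξ0 hp ?_
  have : (k : ℂ) * s * Complex.I = ((k * s : ℝ) : ℂ) * Complex.I := by push_cast; ring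
  rw [this, Complex.add_re, Complex.re_ofReal_mul]; simp

theorem integrable_saddle (hξ0 : 0 ≤ ξ) {p : ℂ} (hp : 0 < p.re) :
    Integrable (fun s : ℝ => Complex.exp (-p * s ^ 2 - Complex.I * s ^ 3 / 3) *
      (p + s * Complex.I) ^ (-(ξ : ℂ))) := by
  refine ((integrable_exp_neg_mul_sq hp).mul_const (p.re ^ (-ξ))).mono' ?_ ?_
  · apply Measurable.aestronglyMeasurable; fun_prop
  · refine Eventually.of_forall fun s => ?_
    simpa using norm_saddle_integrand_le hξ0 hp 1 s

/-- Cauchy's theorem: the vertical line through the saddle point `p`, in the integral of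
`exp(t³/3 - p² t) t ^ (-ξ)`, can be folded onto the two rays `arg t = ± π/3`, which gives a
linear relation with the rotated moments. -/
theorem saddleIntegral_eq (hξ0 : 0 ≤ ξ) (hξ1 : ξ < 1) {p : ℂ} (hp : 0 < p.re) :
    Complex.I * Complex.exp (-2 * p ^ 3 / 3) * saddleIntegral ξ p =
      Complex.exp ((Real.pi / 3 * (1 - ξ) : ℝ) * Complex.I) *
          airyMoment (-ξ) (-(p ^ 2 * rootU 1)) -
        Complex.exp ((-(Real.pi / 3 * (1 - ξ)) : ℝ) * Complex.I) *
          airyMoment (-ξ) (-(p ^ 2 * rootU (-1))) := by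
  obtain ⟨F, hF, hF0⟩ := exists_primitive_mul_cpow (differentiable_airyExp (p ^ 2)) hξ0 hξ1
  have hs3 : 0 < √3 := Real.sqrt_pos.2 (by norm_num)
  have hplus := (tendsto_primitive_vertical hξ0 hξ1 hF hF0 (σ := 1) (by norm_num) hp).comp
    ((tendsto_atTop_add_const_right atTop p.im tendsto_id).atTop_div_const hs3)
  have hminus := (tendsto_primitive_vertical hξ0 hξ1 hF hF0 (σ := -1) (by norm_num) hp).comp
    ((tendsto_atTop_add_const_right atTop (-p.im) tendsto_id).atTop_div_const hs3)
  have hline := (intervalIntegral_tendsto_integral (integrable_saddle hξ0 hp)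
    tendsto_neg_atTop_atBot tendsto_id).const_mul (Complex.I * Complex.exp (-2 * p ^ 3 / 3))
  rw [rootU_one_factor] at hplus
  rw [rootU_neg_one_factor] at hminus
  refine tendsto_nhds_unique hline ((hplus.sub hminus).congr fun R => ?_)
  have e1 : (p.re : ℂ) + (1 * √3 * ((R + p.im) / √3) : ℝ) * Complex.I = p + R * Complex.I := by
    apply Complex.ext
    · simp
    · simp; field_simp; ring
  have e2 : (p.re : ℂ) + (-1 * √3 * ((R + -p.im) / √3) : ℝ) * Complex.I =
      p + (-R : ℝ) * Complex.I := by
    apply Complex.ext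
    · simp
    · simp; field_simp; ring
  simp only [Function.comp_apply, id_eq, e1, e2]
  rw [← intervalIntegral.integral_const_mul]
  refine (intervalIntegral.integral_eq_sub_of_hasDerivAt
    (f := fun s : ℝ => F (p + s * Complex.I)) (fun s _ => ?_) ?_).symm
  · have h1 : HasDerivAt (fun s : ℂ => p + s * Complex.I) Complex.I (s : ℂ) := by
      simpa using ((hasDerivAt_id (s : ℂ)).mul_const Complex.I).const_add p
    have h2 := ((hF (p + s * Complex.I) (by simpa)).comp (s : ℂ) h1).comp_ofReal
    convert! h2 using 1
    have : airyExp (p ^ 2) (p + s * Complex.I) = Complex.exp (-2 * p ^ 3 / 3) *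
        Complex.exp (-p * s ^ 2 - Complex.I * s ^ 3 / 3) := by
      rw [airyExp, ← Complex.exp_add]
      congr 1
      linear_combination (p * s ^ 2 + s ^ 3 * Complex.I / 3) * Complex.I_sq
    rw [this]; ring
  · exact ((integrable_saddle hξ0 hp).const_mul _).intervalIntegrable

/-- The substitution `s ↦ ν⁻¹ s` turns a large saddle point into a small coefficient `ν⁻³` of the
cubic term. -/
theorem saddleIntegral_scale {q : ℂ} (hq : 0 < q.re) {ν : ℝ} (hν : 0 < ν) :
    ((ν ^ (1 + 2 * ξ) : ℝ) : ℂ) * saddleIntegral ξ ((ν ^ 2 : ℝ) * q) =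
      ∫ s : ℝ, Complex.exp (-q * s ^ 2 - Complex.I * ((ν⁻¹ ^ 3 : ℝ) : ℂ) * s ^ 3 / 3) *
        (q + ((ν⁻¹ ^ 3 : ℝ) : ℂ) * s * Complex.I) ^ (-(ξ : ℂ)) := by
  have h1 := Measure.integral_comp_mul_left (fun s : ℝ =>
    Complex.exp (-((ν ^ 2 : ℝ) * q) * s ^ 2 - Complex.I * s ^ 3 / 3) *
      (((ν ^ 2 : ℝ) : ℂ) * q + s * Complex.I) ^ (-(ξ : ℂ))) ν⁻¹
  rw [inv_inv, abs_of_pos hν, Complex.real_smul] at h1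
  have hν' : (ν : ℂ) ≠ 0 := Complex.ofReal_ne_zero.2 hν.ne'
  have e : ∀ s : ℝ, Complex.exp (-((ν ^ 2 : ℝ) * q) * ((ν⁻¹ * s : ℝ) : ℂ) ^ 2 -
        Complex.I * ((ν⁻¹ * s : ℝ) : ℂ) ^ 3 / 3) *
      (((ν ^ 2 : ℝ) : ℂ) * q + ((ν⁻¹ * s : ℝ) : ℂ) * Complex.I) ^ (-(ξ : ℂ)) =
      (((ν ^ 2) ^ (-ξ) : ℝ) : ℂ) *
      (Complex.exp (-q * s ^ 2 - Complex.I * ((ν⁻¹ ^ 3 : ℝ) : ℂ) * s ^ 3 / 3) *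
        (q + ((ν⁻¹ ^ 3 : ℝ) : ℂ) * s * Complex.I) ^ (-(ξ : ℂ))) := by
    intro s
    have h2 : ((ν ^ 2 : ℝ) : ℂ) * q + ((ν⁻¹ * s : ℝ) : ℂ) * Complex.I =
        ((ν ^ 2 : ℝ) : ℂ) * (q + ((ν⁻¹ ^ 3 : ℝ) : ℂ) * s * Complex.I) := by
      push_cast; field_simp
    have h3 : q + ((ν⁻¹ ^ 3 : ℝ) : ℂ) * s * Complex.I ≠ 0 := by
      refine ne_zero_of_re_pos ?_
      rw [mul_assoc, Complex.add_re, Complex.re_ofReal_mul, Complex.re_ofReal_mul]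
      simpa
    have h4 : -((ν ^ 2 : ℝ) * q) * ((ν⁻¹ * s : ℝ) : ℂ) ^ 2 -
        Complex.I * ((ν⁻¹ * s : ℝ) : ℂ) ^ 3 / 3 =
        -q * s ^ 2 - Complex.I * ((ν⁻¹ ^ 3 : ℝ) : ℂ) * s ^ 3 / 3 := by
      push_cast; field_simp
    rw [h2, ofReal_mul_cpow (by positivity) h3, h4]
    ring
  simp_rw [e] at h1
  rw [integral_const_mul] at h1
  have h5 : ν ^ (1 + 2 * ξ) * (ν ^ 2) ^ (-ξ) = ν := by
    rw [← Real.rpow_natCast ν 2, ← Real.rpow_mul hν.le, ← Real.rpow_add hν]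
    have : (1 + 2 * ξ + ((2 : ℕ) : ℝ) * -ξ) = 1 := by push_cast; ring
    rw [this, Real.rpow_one]
  have h5' : ((ν ^ (1 + 2 * ξ) : ℝ) : ℂ) * (((ν ^ 2) ^ (-ξ) : ℝ) : ℂ) = ν := by
    rw [← Complex.ofReal_mul, h5]
  have h6 : saddleIntegral ξ ((ν ^ 2 : ℝ) * q) = ∫ s : ℝ,
      Complex.exp (-((ν ^ 2 : ℝ) * q) * s ^ 2 - Complex.I * s ^ 3 / 3) *
      (((ν ^ 2 : ℝ) : ℂ) * q + s * Complex.I) ^ (-(ξ : ℂ)) := rfl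
  rw [← h6] at h1
  refine mul_left_cancel₀ hν' ?_
  rw [mul_left_comm, ← h1, ← mul_assoc, h5']

/-- Laplace's method on the vertical line: after scaling, dominated convergence applies. -/
theorem tendsto_saddleIntegral (hξ0 : 0 ≤ ξ) {q : ℂ} (hq : 0 < q.re) :
    Tendsto (fun ν : ℝ => ((ν ^ (1 + 2 * ξ) : ℝ) : ℂ) * saddleIntegral ξ ((ν ^ 2 : ℝ) * q)) atTop
      (𝓝 ((Real.pi / q) ^ (1 / 2 : ℂ) * q ^ (-(ξ : ℂ)))) := by
  have hκ : Tendsto (fun ν : ℝ => ν⁻¹ ^ 3) atTop (𝓝 0) := by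
    simpa using (tendsto_inv_atTop_zero (𝕜 := ℝ)).pow 3
  have hgauss : ∫ s : ℝ, Complex.exp (-q * s ^ 2 - Complex.I * ((0 : ℝ) : ℂ) * s ^ 3 / 3) *
      (q + ((0 : ℝ) : ℂ) * s * Complex.I) ^ (-(ξ : ℂ)) =
      (Real.pi / q) ^ (1 / 2 : ℂ) * q ^ (-(ξ : ℂ)) := by
    rw [← integral_gaussian_complex hq, ← integral_mul_const]
    simp
  rw [← hgauss]
  have hdom : Tendsto (fun k : ℝ => ∫ s : ℝ,
      Complex.exp (-q * s ^ 2 - Complex.I * (k : ℂ) * s ^ 3 / 3) *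
      (q + (k : ℂ) * s * Complex.I) ^ (-(ξ : ℂ))) (𝓝 0) (𝓝 (∫ s : ℝ,
      Complex.exp (-q * s ^ 2 - Complex.I * ((0 : ℝ) : ℂ) * s ^ 3 / 3) *
      (q + ((0 : ℝ) : ℂ) * s * Complex.I) ^ (-(ξ : ℂ)))) := by
    refine tendsto_integral_filter_of_dominated_convergence
      (fun s => Real.exp (-q.re * s ^ 2) * q.re ^ (-ξ)) ?_ ?_
      ((integrable_exp_neg_mul_sq hq).mul_const (q.re ^ (-ξ))) ?_
    · refine Eventually.of_forall fun k => ?_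
      apply Measurable.aestronglyMeasurable; fun_prop
    · exact Eventually.of_forall fun k => Eventually.of_forall fun s =>
        norm_saddle_integrand_le hξ0 hq k s
    · refine Eventually.of_forall fun s => ?_
      have hslit : q + ((0 : ℝ) : ℂ) * s * Complex.I ∈ Complex.slitPlane := by
        left; simpa
      have : ContinuousAt (fun k : ℝ =>
          Complex.exp (-q * s ^ 2 - Complex.I * (k : ℂ) * s ^ 3 / 3) *
          (q + (k : ℂ) * s * Complex.I) ^ (-(ξ : ℂ))) 0 := by
        refine ContinuousAt.mul (by fun_prop) ?_
        exact ContinuousAt.cpow (by fun_prop) continuousAt_const hslit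
      exact this.tendsto
  refine (hdom.comp hκ).congr' ?_
  filter_upwards [eventually_gt_atTop 0] with ν hν
  exact (saddleIntegral_scale hq hν).symm

end

/-! ### Behaviour at `+∞` -/

noncomputable section

variable {ξ : ℝ}

/-- The limit of the saddle point integral in terms of the variable `θ = ν⁴` of the equation. -/
theorem tendsto_saddleIntegral_sqrt (hξ0 : 0 ≤ ξ) {q : ℂ} (hq : 0 < q.re) :
    Tendsto (fun θ : ℝ => ((θ ^ (-((1 - ξ) / 2 - 3 / 4)) : ℝ) : ℂ) *
      saddleIntegral ξ ((√θ : ℝ) * q)) atTop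
      (𝓝 ((Real.pi / q) ^ (1 / 2 : ℂ) * q ^ (-(ξ : ℂ)))) := by
  refine ((tendsto_saddleIntegral hξ0 hq).comp
    (tendsto_rpow_atTop (by norm_num : (0 : ℝ) < 1 / 4))).congr' ?_
  filter_upwards [eventually_gt_atTop 0] with θ hθ
  simp only [Function.comp_apply]
  rw [← Real.rpow_natCast (θ ^ (1 / 4 : ℝ)) 2, ← Real.rpow_mul hθ.le, ← Real.rpow_mul hθ.le,
    Real.sqrt_eq_rpow]
  congr 3
  · ring
  · congr 2; norm_num

theorem cexp_pi_div_two : Complex.exp ((Real.pi / 2 : ℝ) * Complex.I) = Complex.I := by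
  push_cast; exact Complex.exp_pi_div_two_mul_I

theorem sqrt_pow_three {θ : ℝ} (hθ : 0 ≤ θ) : √θ ^ 3 = θ ^ (3 / 2 : ℝ) := by
  rw [Real.sqrt_eq_rpow, ← Real.rpow_natCast, ← Real.rpow_mul hθ]; norm_num

theorem ofReal_sqrt_sq {θ : ℝ} (hθ : 0 ≤ θ) : ((√θ : ℝ) : ℂ) ^ 2 = θ := by
  rw [← Complex.ofReal_pow, Real.sq_sqrt hθ]

theorem ofReal_sqrt_pow_three {θ : ℝ} (hθ : 0 ≤ θ) :
    ((√θ : ℝ) : ℂ) ^ 3 = ((θ ^ (3 / 2 : ℝ) : ℝ) : ℂ) := by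
  rw [← Complex.ofReal_pow, sqrt_pow_three hθ]

/-- Argument of the leading coefficient of the saddle point integral on the ray `arg q = φ`. -/
theorem gaussian_factor {φ : ℝ} (h1 : -Real.pi < φ) (h2 : φ < Real.pi) (ξ : ℝ) :
    (Real.pi / Complex.exp (φ * Complex.I)) ^ (1 / 2 : ℂ) *
      Complex.exp (φ * Complex.I) ^ (-(ξ : ℂ)) =
      (√Real.pi : ℝ) * Complex.exp ((-(φ / 2 + ξ * φ) : ℝ) * Complex.I) := by
  have e : (Real.pi : ℂ) / Complex.exp (φ * Complex.I) =
      (Real.pi : ℂ) * Complex.exp ((-φ : ℝ) * Complex.I) := by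
    rw [div_eq_mul_inv, ← Complex.exp_neg]; push_cast; ring_nf
  have e2 : (1 / 2 : ℂ) = -((-(1 / 2) : ℝ) : ℂ) := by push_cast; ring
  rw [e, e2, ofReal_mul_cpow Real.pi_pos (Complex.exp_ne_zero _),
    cexp_mul_I_cpow (by linarith) (by linarith), cexp_mul_I_cpow h1 h2.le, mul_assoc,
    ← Complex.exp_add, neg_neg, ← Real.sqrt_eq_rpow]
  congr 2
  push_cast; ring

theorem rootU_neg_one_eq_neg : rootU (-1) = -cubeRoot := by
  apply Complex.ext
  · simp [rootU, cubeRoot]; norm_num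
  · simp [rootU, cubeRoot]

theorem conj_cubeRoot : starRingEnd ℂ cubeRoot = -rootU 1 := by
  apply Complex.ext
  · simp [rootU, cubeRoot]; norm_num
  · simp [rootU, cubeRoot]

theorem rootU_one_sq : rootU 1 ^ 2 = cubeRoot := by
  rw [rootU_eq, cubeRoot_eq]
  push_cast
  linear_combination (√3 ^ 2 / 4 : ℂ) * Complex.I_sq - (1 / 4 : ℂ) * ofReal_sqrt_three_sq

theorem rootU_one_eq_neg_sq : rootU 1 = -cubeRoot ^ 2 := by
  rw [rootU_eq, cubeRoot_eq]
  push_cast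
  linear_combination (√3 ^ 2 / 4 : ℂ) * Complex.I_sq - (1 / 4 : ℂ) * ofReal_sqrt_three_sq

/-- On the real axis the saddle integral is the recessive solution `Lb`. -/
theorem two_mul_Lb_eq (hξ0 : 0 ≤ ξ) (hξ1 : ξ < 1) {θ : ℝ} (hθ : 0 < θ) :
    2 * ((Lb ξ θ : ℝ) : ℂ) =
      Real.exp (-2 * θ ^ (3 / 2 : ℝ) / 3) * saddleIntegral ξ ((√θ : ℝ) * 1) := by
  have h := saddleIntegral_eq (p := ((√θ : ℝ) : ℂ) * 1) hξ0 hξ1 (by simpa)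
  have e1 : -((((√θ : ℝ) : ℂ) * 1) ^ 2 * rootU 1) = starRingEnd ℂ (cubeRoot * θ) := by
    rw [map_mul, conj_cubeRoot, Complex.conj_ofReal, mul_one, ofReal_sqrt_sq hθ.le]; ring
  have e2 : -((((√θ : ℝ) : ℂ) * 1) ^ 2 * rootU (-1)) = cubeRoot * θ := by
    rw [rootU_neg_one_eq_neg, mul_one, ofReal_sqrt_sq hθ.le]; ring
  rw [e1, e2, airyMoment_conj, mul_one, ofReal_sqrt_pow_three hθ.le] at h
  set y := Complex.exp ((-(Real.pi / 3 * (1 - ξ)) : ℝ) * Complex.I) *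
    airyMoment (-ξ) (cubeRoot * θ) with hy
  have e3 : Complex.exp ((Real.pi / 3 * (1 - ξ) : ℝ) * Complex.I) *
      starRingEnd ℂ (airyMoment (-ξ) (cubeRoot * θ)) = starRingEnd ℂ y := by
    rw [hy, map_mul, ← Complex.exp_conj, map_mul, Complex.conj_ofReal, Complex.conj_I]
    congr 2; push_cast; ring
  have e4 : Complex.exp ((Real.pi / 6 + ξ * Real.pi / 3 : ℝ) * Complex.I) *
      airyMoment (-ξ) (cubeRoot * θ) = Complex.I * y := by
    rw [hy, ← mul_assoc]
    congr 1
    nth_rewrite 2 [← cexp_pi_div_two]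
    rw [← Complex.exp_add]
    congr 1; push_cast; ring
  rw [Lb_eq_re hξ0 hξ1, e4, mul_one, Complex.ofReal_exp]
  have e5 : ((-2 * θ ^ (3 / 2 : ℝ) / 3 : ℝ) : ℂ) = -2 * ((θ ^ (3 / 2 : ℝ) : ℝ) : ℂ) / 3 := by
    push_cast; ring
  rw [e3] at h
  rw [e5]
  have e6 : ((Complex.I * y).re : ℂ) = (Complex.I * y + starRingEnd ℂ (Complex.I * y)) / 2 :=
    Complex.re_eq_add_conj _
  rw [e6, map_mul, Complex.conj_I]
  refine mul_left_cancel₀ Complex.I_ne_zero ?_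
  linear_combination (y - starRingEnd ℂ y) * Complex.I_sq - h

theorem Lb_isEquivalent_atTop (hξ0 : 0 ≤ ξ) (hξ1 : ξ < 1) :
    Lb ξ ~[atTop] fun θ : ℝ =>
      √Real.pi / 2 * θ ^ ((1 - ξ) / 2 - 3 / 4) * Real.exp (-2 * θ ^ (3 / 2 : ℝ) / 3) := by
  have hpi : 0 < √Real.pi := Real.sqrt_pos.2 Real.pi_pos
  refine (isEquivalent_iff_tendsto_one ?_).2 ?_
  · filter_upwards [eventually_gt_atTop 0] with θ hθ
    positivity
  have h := tendsto_saddleIntegral_sqrt hξ0 (q := 1) (by simp)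
  have h1 := gaussian_factor (φ := 0) (by linarith [Real.pi_pos]) Real.pi_pos ξ
  simp only [Complex.ofReal_zero, zero_mul, Complex.exp_zero, zero_div, mul_zero, add_zero,
    neg_zero, mul_one] at h1
  rw [h1] at h
  have h2 := (Complex.continuous_re.tendsto _).comp (h.div_const ((√Real.pi : ℝ) : ℂ))
  rw [div_self (Complex.ofReal_ne_zero.2 hpi.ne'), Complex.one_re] at h2
  refine h2.congr' ?_
  filter_upwards [eventually_gt_atTop 0] with θ hθ
  have e := two_mul_Lb_eq hξ0 hξ1 hθ
  have hexp : ((Real.exp (-2 * θ ^ (3 / 2 : ℝ) / 3) : ℝ) : ℂ) ≠ 0 :=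
    Complex.ofReal_ne_zero.2 (Real.exp_ne_zero _)
  have e' : saddleIntegral ξ ((√θ : ℝ) * 1) =
      ((2 * Lb ξ θ / Real.exp (-2 * θ ^ (3 / 2 : ℝ) / 3) : ℝ) : ℂ) := by
    push_cast
    push_cast at e hexp
    rw [e]
    field_simp
  simp only [Function.comp_apply, Pi.div_apply]
  rw [e', ← Complex.ofReal_mul, ← Complex.ofReal_div, Complex.ofReal_re, Real.rpow_neg hθ.le]
  field_simp

/-- The moments stay bounded on the ray `arg z = 2π/3`, where the kernel decays. -/
theorem norm_airyMoment_cubeRoot_le {s : ℝ} (hs : -1 < s) {θ : ℝ} (hθ : 0 ≤ θ) :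
    ‖airyMoment s (cubeRoot * θ)‖ ≤
      ∫ r in Ioi (0 : ℝ), Real.exp (-r ^ 3 / 3 + (0 : ℂ).re * r) * r ^ s := by
  have hint : IntegrableOn (fun r : ℝ => Real.exp (-r ^ 3 / 3 + (0 : ℂ).re * r) * r ^ s)
      (Ioi 0) :=
    IntegrableOn.congr_fun (integrableOn_airyMoment hs 0).norm
      (fun r hr => norm_airyMoment_integrand s 0 hr) measurableSet_Ioi
  refine norm_integral_le_of_norm_le hint ?_
  filter_upwards [ae_restrict_mem measurableSet_Ioi] with r hr
  have hr : 0 < r := hr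
  rw [norm_airyMoment_integrand s _ hr]
  refine mul_le_mul_of_nonneg_right (Real.exp_le_exp.2 ?_) (by positivity)
  rw [Complex.re_mul_ofReal]
  have : cubeRoot.re = -1 / 2 := rfl
  rw [this, Complex.zero_re]
  nlinarith [mul_nonneg hθ hr.le]

/-- The saddle formula on the ray `arg p = -π/3` expresses `La` through a growing saddle
contribution and a bounded moment. -/
theorem La_eq_saddle (hξ0 : 0 ≤ ξ) (hξ1 : ξ < 1) {θ : ℝ} (hθ : 0 < θ) :
    ((La ξ θ : ℝ) : ℂ) =
      Complex.exp ((2 * (Real.pi / 3 * (1 - ξ)) : ℝ) * Complex.I) *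
        airyMoment (-ξ) (cubeRoot * θ) -
      Complex.I * Complex.exp ((Real.pi / 3 * (1 - ξ) : ℝ) * Complex.I) *
        (Real.exp (2 * θ ^ (3 / 2 : ℝ) / 3) * saddleIntegral ξ ((√θ : ℝ) * rootU (-1))) := by
  have hre : 0 < (((√θ : ℝ) : ℂ) * rootU (-1)).re := by
    rw [Complex.re_ofReal_mul, rootU_re]; positivity
  have h := saddleIntegral_eq hξ0 hξ1 hre
  have e1 : -((((√θ : ℝ) : ℂ) * rootU (-1)) ^ 2 * rootU 1) = cubeRoot * θ := by
    rw [mul_pow, ofReal_sqrt_sq hθ.le, rootU_neg_one_eq_neg, rootU_one_eq_neg_sq]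
    linear_combination θ * cubeRoot * cubeRoot_pow_three
  have e2 : -((((√θ : ℝ) : ℂ) * rootU (-1)) ^ 2 * rootU (-1)) = θ := by
    rw [mul_pow, ofReal_sqrt_sq hθ.le]
    linear_combination -θ * rootU_pow_three (σ := -1) (by norm_num)
  have e3 : -2 * (((√θ : ℝ) : ℂ) * rootU (-1)) ^ 3 / 3 = ((2 * θ ^ (3 / 2 : ℝ) / 3 : ℝ) : ℂ) := by
    rw [mul_pow, ofReal_sqrt_pow_three hθ.le, rootU_pow_three (σ := -1) (by norm_num)]
    push_cast; ring
  rw [e1, e2, e3, ← La_eq_airyMoment, ← Complex.ofReal_exp] at h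
  set α := Real.pi / 3 * (1 - ξ)
  have e4 : Complex.exp ((2 * α : ℝ) * Complex.I) =
      Complex.exp (α * Complex.I) * Complex.exp (α * Complex.I) := by
    rw [← Complex.exp_add]; congr 1; push_cast; ring
  have e5 : Complex.exp (α * Complex.I) * Complex.exp ((-α : ℝ) * Complex.I) = 1 := by
    rw [← Complex.exp_add, ← Complex.exp_zero]; congr 1; push_cast; ring
  rw [e4]
  linear_combination (Complex.exp (α * Complex.I)) * h - ((La ξ θ : ℝ) : ℂ) * e5

theorem La_isEquivalent_atTop (hξ0 : 0 ≤ ξ) (hξ1 : ξ < 1) :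
    La ξ ~[atTop] fun θ : ℝ =>
      √Real.pi * θ ^ ((1 - ξ) / 2 - 3 / 4) * Real.exp (2 * θ ^ (3 / 2 : ℝ) / 3) := by
  have hpi : 0 < √Real.pi := Real.sqrt_pos.2 Real.pi_pos
  refine (isEquivalent_iff_tendsto_one ?_).2 ?_
  · filter_upwards [eventually_gt_atTop 0] with θ hθ
    positivity
  have h := tendsto_saddleIntegral_sqrt hξ0 (q := rootU (-1)) (by rw [rootU_re]; norm_num)
  rw [← cexp_neg_pi_div_three, gaussian_factor (by linarith [Real.pi_pos])
    (by linarith [Real.pi_pos]), cexp_neg_pi_div_three] at h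
  have h2 := h.const_mul (-(Complex.I * Complex.exp ((Real.pi / 3 * (1 - ξ) : ℝ) * Complex.I)) /
    ((√Real.pi : ℝ) : ℂ))
  -- the recessive term
  have hsmall : Tendsto (fun θ : ℝ => ((θ ^ (-((1 - ξ) / 2 - 3 / 4)) *
      Real.exp (-(2 / 3) * θ ^ (3 / 2 : ℝ)) / √Real.pi : ℝ) : ℂ) *
      (Complex.exp ((2 * (Real.pi / 3 * (1 - ξ)) : ℝ) * Complex.I) *
        airyMoment (-ξ) (cubeRoot * θ))) atTop (𝓝 0) := by
    have hr : Tendsto (fun θ : ℝ => θ ^ (-((1 - ξ) / 2 - 3 / 4)) *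
        Real.exp (-(2 / 3) * θ ^ (3 / 2 : ℝ)) / √Real.pi) atTop (𝓝 0) := by
      have h3 := (tendsto_rpow_mul_exp_neg_mul_atTop_nhds_zero
        (-((1 - ξ) / 2 - 3 / 4) * (2 / 3)) (2 / 3) (by norm_num)).comp
        (tendsto_rpow_atTop (by norm_num : (0 : ℝ) < 3 / 2))
      have h4 := h3.div_const √Real.pi
      rw [zero_div] at h4
      refine h4.congr' ?_
      filter_upwards [eventually_gt_atTop 0] with θ hθ
      simp only [Function.comp_apply]
      rw [← Real.rpow_mul hθ.le]
      congr 3; ring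
    refine Tendsto.zero_mul_isBoundedUnder_le ?_ ?_
    · have := (Complex.continuous_ofReal.tendsto _).comp hr
      rwa [Complex.ofReal_zero] at this
    · refine ⟨∫ r in Ioi (0 : ℝ), Real.exp (-r ^ 3 / 3 + (0 : ℂ).re * r) * r ^ (-ξ),
        eventually_map.2 ?_⟩
      filter_upwards [eventually_ge_atTop 0] with θ hθ
      simp only [Function.comp_apply]
      rw [norm_mul, Complex.norm_exp_ofReal_mul_I, one_mul]
      exact norm_airyMoment_cubeRoot_le (by linarith) hθ
  have h3 := (Complex.continuous_re.tendsto _).comp (hsmall.add h2)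
  have hc : 0 + -(Complex.I * Complex.exp ((Real.pi / 3 * (1 - ξ) : ℝ) * Complex.I)) /
      ((√Real.pi : ℝ) : ℂ) * ((√Real.pi : ℝ) *
        Complex.exp ((-(-(Real.pi / 3) / 2 + ξ * -(Real.pi / 3)) : ℝ) * Complex.I)) = 1 := by
    have hp0 : ((√Real.pi : ℝ) : ℂ) ≠ 0 := Complex.ofReal_ne_zero.2 hpi.ne'
    have : Complex.exp ((Real.pi / 3 * (1 - ξ) : ℝ) * Complex.I) *
        Complex.exp ((-(-(Real.pi / 3) / 2 + ξ * -(Real.pi / 3)) : ℝ) * Complex.I) =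
        Complex.I := by
      rw [← Complex.exp_add, ← add_mul, ← Complex.ofReal_add]
      convert! cexp_pi_div_two using 4
      ring
    rw [zero_add, div_mul_eq_mul_div, div_eq_one_iff_eq hp0]
    linear_combination (-Complex.I * ((√Real.pi : ℝ) : ℂ)) * this -
      ((√Real.pi : ℝ) : ℂ) * Complex.I_sq
  rw [hc, Complex.one_re] at h3
  refine h3.congr' ?_
  filter_upwards [eventually_gt_atTop 0] with θ hθ
  simp only [Function.comp_apply, Pi.div_apply]
  rw [← Complex.ofReal_re (La ξ θ / _)]
  congr 1
  rw [Complex.ofReal_div (La ξ θ), La_eq_saddle hξ0 hξ1 hθ, Real.rpow_neg hθ.le,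
    show -(2 / 3) * θ ^ (3 / 2 : ℝ) = -(2 * θ ^ (3 / 2 : ℝ) / 3) by ring, Real.exp_neg]
  have hp0 : ((√Real.pi : ℝ) : ℂ) ≠ 0 := Complex.ofReal_ne_zero.2 hpi.ne'
  have hp1 : ((θ ^ ((1 - ξ) / 2 - 3 / 4) : ℝ) : ℂ) ≠ 0 :=
    Complex.ofReal_ne_zero.2 (Real.rpow_pos_of_pos hθ _).ne'
  have hp2 : ((Real.exp (2 * θ ^ (3 / 2 : ℝ) / 3) : ℝ) : ℂ) ≠ 0 :=
    Complex.ofReal_ne_zero.2 (Real.exp_ne_zero _)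
  rw [Complex.ofReal_mul (√Real.pi * _), Complex.ofReal_mul √Real.pi, Complex.ofReal_div,
    Complex.ofReal_mul, Complex.ofReal_inv, Complex.ofReal_inv]
  generalize ((Real.exp (2 * θ ^ (3 / 2 : ℝ) / 3) : ℝ) : ℂ) = A at *
  generalize ((θ ^ ((1 - ξ) / 2 - 3 / 4) : ℝ) : ℂ) = B at *
  field_simp
  ring

/-- Rescaling the variable of integration by `θ⁻¹`. -/
theorem airyMoment_scale (s : ℝ) (a : ℂ) {θ : ℝ} (hθ : 0 < θ) :
    ((θ ^ (1 + s) : ℝ) : ℂ) * airyMoment s (a * θ) =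
      ∫ u in Ioi (0 : ℝ), Complex.exp (-((θ⁻¹ ^ 3 : ℝ) : ℂ) * u ^ 3 / 3 + a * u) *
        ((u ^ s : ℝ) : ℂ) := by
  have h := integral_comp_mul_left_Ioi (fun r : ℝ =>
    Complex.exp (-(r : ℂ) ^ 3 / 3 + a * θ * r) * ((r ^ s : ℝ) : ℂ)) 0 (inv_pos.2 hθ)
  rw [inv_inv, mul_zero, Complex.real_smul] at h
  have hθ' : (θ : ℂ) ≠ 0 := Complex.ofReal_ne_zero.2 hθ.ne'
  have e : airyMoment s (a * θ) = ∫ r in Ioi (0 : ℝ),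
    Complex.exp (-(r : ℂ) ^ 3 / 3 + a * θ * r) * ((r ^ s : ℝ) : ℂ) := rfl
  rw [Real.rpow_add hθ, Real.rpow_one, mul_comm θ, Complex.ofReal_mul, mul_assoc, e, ← h,
    ← integral_const_mul]
  refine setIntegral_congr_fun measurableSet_Ioi fun u hu => ?_
  have hu : 0 < u := hu
  have e1 : θ ^ s * (θ⁻¹ * u) ^ s = u ^ s := by
    rw [← Real.mul_rpow hθ.le (by positivity), mul_inv_cancel_left₀ hθ.ne']
  have e2 : -(((θ⁻¹ * u : ℝ) : ℂ)) ^ 3 / 3 + a * θ * ((θ⁻¹ * u : ℝ) : ℂ) =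
      -((θ⁻¹ ^ 3 : ℝ) : ℂ) * u ^ 3 / 3 + a * u := by
    push_cast; field_simp
  rw [e2, ← e1]
  push_cast; ring

/-- Away from the sector of exponential growth the moment is governed by the singularity of the
integrand at `r = 0`. -/
theorem tendsto_airyMoment_cubeRoot (hξ0 : 0 ≤ ξ) (hξ1 : ξ < 1) :
    Tendsto (fun θ : ℝ => ((θ ^ (1 - ξ) : ℝ) : ℂ) * airyMoment (-ξ) (cubeRoot * θ)) atTop
      (𝓝 (Real.Gamma (1 - ξ) *
        Complex.exp ((Real.pi / 3 * (1 - ξ) : ℝ) * Complex.I))) := by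
  have hκ : Tendsto (fun ν : ℝ => ν⁻¹ ^ 3) atTop (𝓝 0) := by
    simpa using (tendsto_inv_atTop_zero (𝕜 := ℝ)).pow 3
  have hdom : Tendsto (fun θ : ℝ => ∫ u in Ioi (0 : ℝ),
      Complex.exp (-((θ⁻¹ ^ 3 : ℝ) : ℂ) * u ^ 3 / 3 + cubeRoot * u) * ((u ^ (-ξ) : ℝ) : ℂ)) atTop
      (𝓝 (∫ u in Ioi (0 : ℝ),
        Complex.exp (-((0 : ℝ) : ℂ) * u ^ 3 / 3 + cubeRoot * u) * ((u ^ (-ξ) : ℝ) : ℂ))) := by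
    refine tendsto_integral_filter_of_dominated_convergence
      (fun u => u ^ (-ξ) * Real.exp (-(1 / 2) * u ^ (1 : ℝ))) ?_ ?_
      (integrableOn_rpow_mul_exp_neg_mul_rpow (by linarith) one_pos (by norm_num)) ?_
    · refine Eventually.of_forall fun k => ?_
      apply Measurable.aestronglyMeasurable; fun_prop
    · filter_upwards [eventually_gt_atTop 0] with θ hθ
      filter_upwards [ae_restrict_mem measurableSet_Ioi] with u hu
      have hu : 0 < u := hu
      rw [norm_mul, Complex.norm_real, Real.norm_of_nonneg (by positivity), mul_comm,
        Complex.norm_exp, Real.rpow_one]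
      gcongr
      have e : -((θ⁻¹ ^ 3 : ℝ) : ℂ) * u ^ 3 / 3 + cubeRoot * u =
          ((-(θ⁻¹ ^ 3) * u ^ 3 / 3 : ℝ) : ℂ) + cubeRoot * u := by push_cast; ring
      have e2 : cubeRoot.re = -1 / 2 := rfl
      rw [e, Complex.add_re, Complex.ofReal_re, Complex.re_mul_ofReal, e2]
      have : 0 ≤ θ⁻¹ ^ 3 * u ^ 3 := by positivity
      linarith
    · refine Eventually.of_forall fun u => ?_
      have : Continuous fun k : ℝ => Complex.exp (-(k : ℂ) * u ^ 3 / 3 + cubeRoot * u) *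
        ((u ^ (-ξ) : ℝ) : ℂ) := by fun_prop
      exact (this.tendsto 0).comp hκ
  have hval : ∫ u in Ioi (0 : ℝ),
      Complex.exp (-((0 : ℝ) : ℂ) * u ^ 3 / 3 + cubeRoot * u) * ((u ^ (-ξ) : ℝ) : ℂ) =
      Real.Gamma (1 - ξ) * Complex.exp ((Real.pi / 3 * (1 - ξ) : ℝ) * Complex.I) := by
    have h := integral_exp_neg_mul_rpow hξ0 hξ1 (v := rootU (-1)) (by rw [rootU_re]; norm_num)
    rw [rootU_neg_one_factor] at h
    rw [← h, mul_assoc, ← Complex.exp_add, rootU_neg_one_eq_neg]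
    have : ((-(Real.pi / 3 * (1 - ξ)) : ℝ) : ℂ) * Complex.I +
      (Real.pi / 3 * (1 - ξ) : ℝ) * Complex.I = 0 := by push_cast; ring
    rw [this, Complex.exp_zero, mul_one]
    simp
  rw [hval] at hdom
  refine hdom.congr' ?_
  filter_upwards [eventually_gt_atTop 0] with θ hθ
  rw [sub_eq_add_neg, airyMoment_scale _ _ hθ]

/-- The factor `sin(ξπ)` is the real part of the limit of the moment on `arg z = 2π/3`, multiplied
by the phase that defines `Lc`; it does not vanish, so that `Lc` decays only algebraically. -/
theorem Lc_isEquivalent_atTop (hξ0 : 0 < ξ) (hξ1 : ξ < 1) :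
    Lc ξ ~[atTop] fun θ : ℝ =>
      Real.sin (ξ * Real.pi) * θ ^ (-(1 - ξ)) * Real.Gamma (1 - ξ) := by
  have hsin : 0 < Real.sin (ξ * Real.pi) :=
    Real.sin_pos_of_pos_of_lt_pi (by positivity) (by nlinarith [Real.pi_pos])
  have hG : 0 < Real.Gamma (1 - ξ) := Real.Gamma_pos_of_pos (by linarith)
  refine (isEquivalent_iff_tendsto_one ?_).2 ?_
  · filter_upwards [eventually_gt_atTop 0] with θ hθ
    positivity
  have h := (Complex.continuous_re.tendsto _).comp
    ((tendsto_airyMoment_cubeRoot hξ0.le hξ1).const_mul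
      (Complex.exp ((Real.pi / 6 - 2 * ξ * Real.pi / 3 : ℝ) * Complex.I)))
  have e : (Complex.exp ((Real.pi / 6 - 2 * ξ * Real.pi / 3 : ℝ) * Complex.I) *
      (Real.Gamma (1 - ξ) * Complex.exp ((Real.pi / 3 * (1 - ξ) : ℝ) * Complex.I))).re =
      Real.Gamma (1 - ξ) * Real.sin (ξ * Real.pi) := by
    rw [mul_left_comm, ← Complex.exp_add, ← add_mul, ← Complex.ofReal_add, Complex.re_ofReal_mul,
      Complex.exp_ofReal_mul_I_re, ← Real.cos_pi_div_two_sub]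
    congr 2; ring
  rw [e] at h
  have h2 := h.div_const (Real.Gamma (1 - ξ) * Real.sin (ξ * Real.pi))
  rw [div_self (by positivity)] at h2
  refine h2.congr' ?_
  filter_upwards [eventually_gt_atTop 0] with θ hθ
  simp only [Function.comp_apply, Pi.div_apply]
  rw [mul_left_comm, Complex.re_ofReal_mul, ← Lc_eq_re hξ0.le hξ1, Real.rpow_neg hθ.le]
  field_simp

/-- On the negative axis `exp(2πi/3) θ` is reached by the saddle formula on the ray
`arg p = π/6`, which splits the moment there into `La` and an oscillating saddle contribution. -/
theorem airyMoment_cubeRoot_neg (hξ0 : 0 ≤ ξ) (hξ1 : ξ < 1) {x : ℝ} (hx : 0 < x) :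
    airyMoment (-ξ) (cubeRoot * (-x : ℝ)) =
      Complex.exp ((-(2 * Real.pi / 3 * (1 - ξ)) : ℝ) * Complex.I) * La ξ (-x) +
      Complex.exp ((Real.pi / 2 - Real.pi / 3 * (1 - ξ) - 2 / 3 * x ^ (3 / 2 : ℝ) : ℝ) *
        Complex.I) *
        saddleIntegral ξ ((√x : ℝ) * Complex.exp ((Real.pi / 6 : ℝ) * Complex.I)) := by
  set q := Complex.exp ((Real.pi / 6 : ℝ) * Complex.I) with hq
  have hqre : 0 < q.re := by rw [hq, cexp_pi_div_six]; simp
  have hre : 0 < (((√x : ℝ) : ℂ) * q).re := by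
    rw [Complex.re_ofReal_mul]; positivity
  have hq2 : q ^ 2 = rootU 1 := by
    rw [hq, ← cexp_pi_div_three, ← Complex.exp_nat_mul]; congr 1; push_cast; ring
  have hq3 : q ^ 3 = Complex.I := by
    rw [hq, ← Complex.exp_nat_mul]
    refine Eq.trans ?_ cexp_pi_div_two
    congr 1; push_cast; ring
  have h := saddleIntegral_eq hξ0 hξ1 hre
  have e1 : -((((√x : ℝ) : ℂ) * q) ^ 2 * rootU 1) = cubeRoot * (-x : ℝ) := by
    rw [mul_pow, ofReal_sqrt_sq hx.le, hq2, ← rootU_one_sq]; push_cast; ring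
  have e2 : -((((√x : ℝ) : ℂ) * q) ^ 2 * rootU (-1)) = (-x : ℝ) := by
    rw [mul_pow, ofReal_sqrt_sq hx.le, hq2, rootU_neg_one_eq_neg, rootU_one_eq_neg_sq]
    push_cast
    linear_combination -x * cubeRoot_pow_three
  have e3 : -2 * (((√x : ℝ) : ℂ) * q) ^ 3 / 3 =
      ((-(2 / 3 * x ^ (3 / 2 : ℝ)) : ℝ) : ℂ) * Complex.I := by
    rw [mul_pow, ofReal_sqrt_pow_three hx.le, hq3]
    push_cast; ring
  rw [e1, e2, e3, ← La_eq_airyMoment] at h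
  set α := Real.pi / 3 * (1 - ξ) with hα
  have e4 : Complex.exp ((-(2 * Real.pi / 3 * (1 - ξ)) : ℝ) * Complex.I) =
      Complex.exp ((-α : ℝ) * Complex.I) * Complex.exp ((-α : ℝ) * Complex.I) := by
    rw [← Complex.exp_add, hα]; congr 1; push_cast; ring
  have e5 : Complex.exp ((-α : ℝ) * Complex.I) * Complex.exp (α * Complex.I) = 1 := by
    rw [← Complex.exp_add, ← Complex.exp_zero]; congr 1; push_cast; ring
  have e6 : Complex.exp ((Real.pi / 2 - α - 2 / 3 * x ^ (3 / 2 : ℝ) : ℝ) * Complex.I) =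
      Complex.exp ((-α : ℝ) * Complex.I) * (Complex.I *
        Complex.exp (((-(2 / 3 * x ^ (3 / 2 : ℝ)) : ℝ) : ℂ) * Complex.I)) := by
    nth_rewrite 3 [← cexp_pi_div_two]
    rw [← Complex.exp_add, ← Complex.exp_add]; congr 1; push_cast; ring
  rw [e4, e6]
  linear_combination (-Complex.exp ((-α : ℝ) * Complex.I)) * h -
    (airyMoment (-ξ) (cubeRoot * (-x : ℝ))) * e5

end

/-! ### Behaviour at `-∞` -/

noncomputable section

variable {ξ : ℝ}

/-- Two values of the sine can be realised at angles as close as their arcsines. -/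
theorem exists_sin_eq_abs_sub_eq (a : ℝ) {t : ℝ} (h1 : -1 ≤ t) (h2 : t ≤ 1) :
    ∃ b, Real.sin b = t ∧ |b - a| = |Real.arcsin t - Real.arcsin (Real.sin a)| := by
  have hs : Real.sin (Real.arcsin (Real.sin a)) = Real.sin a :=
    Real.sin_arcsin (Real.neg_one_le_sin a) (Real.sin_le_one a)
  obtain ⟨k, hk | hk⟩ := Real.sin_eq_sin_iff.1 hs
  · refine ⟨Real.arcsin t + k * (2 * Real.pi), ?_, ?_⟩
    · rw [Real.sin_add_int_mul_two_pi, Real.sin_arcsin h1 h2]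
    · congr 1; linarith
  · refine ⟨Real.pi - Real.arcsin t + k * (2 * Real.pi), ?_, ?_⟩
    · rw [Real.sin_add_int_mul_two_pi, Real.sin_pi_sub, Real.sin_arcsin h1 h2]
    · rw [abs_sub_comm (Real.arcsin t)]; congr 1; linarith

/-- A vanishing additive perturbation of a sine can be traded for a vanishing shift of the phase
together with an amplitude factor tending to `1`. The factor `1 + |η|` brings the perturbed value
back to `[-1, 1]`, and the shift is controlled by the uniform continuity of `arcsin`. -/
theorem exists_phase_shift {α : Type*} {l : Filter α} (a : α → ℝ) {η : α → ℝ}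
    (hη : Tendsto η l (𝓝 0)) :
    ∃ w ε : α → ℝ, Tendsto w l (𝓝 0) ∧ Tendsto ε l (𝓝 0) ∧
      ∀ x, Real.sin (a x) + η x = Real.sin (a x + w x) * (1 + ε x) := by
  set t : α → ℝ := fun x => (Real.sin (a x) + η x) / (1 + |η x|) with ht
  have hpos : ∀ x, 0 < 1 + |η x| := fun x => by positivity
  have ht1 : ∀ x, -1 ≤ t x := fun x => by
    rw [ht, le_div_iff₀ (hpos x)]
    linarith [Real.neg_one_le_sin (a x), neg_abs_le (η x)]
  have ht2 : ∀ x, t x ≤ 1 := fun x => by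
    rw [ht, div_le_one (hpos x)]
    linarith [Real.sin_le_one (a x), le_abs_self (η x)]
  have hdist : ∀ x, |t x - Real.sin (a x)| ≤ 2 * |η x| := fun x => by
    have e : t x - Real.sin (a x) = (η x - Real.sin (a x) * |η x|) / (1 + |η x|) := by
      rw [ht]; have := (hpos x).ne'; field_simp; ring
    rw [e, abs_div, abs_of_pos (hpos x)]
    refine (div_le_self (abs_nonneg _) (by linarith [abs_nonneg (η x)])).trans ?_
    refine (abs_sub _ _).trans ?_
    rw [abs_mul, abs_abs]
    nlinarith [Real.abs_sin_le_one (a x), abs_nonneg (η x)]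
  choose b hb1 hb2 using fun x => exists_sin_eq_abs_sub_eq (a x) (ht1 x) (ht2 x)
  refine ⟨fun x => b x - a x, fun x => |η x|, ?_, ?_, fun x => ?_⟩
  · have huc := isCompact_Icc.uniformContinuousOn_of_continuous
      (Real.continuous_arcsin.continuousOn (s := Icc (-1 : ℝ) 1))
    rw [Metric.uniformContinuousOn_iff] at huc
    rw [Metric.tendsto_nhds]
    intro e he
    obtain ⟨d, hd, hd2⟩ := huc e he
    have hη2 : Tendsto (fun x => 2 * |η x|) l (𝓝 0) := by simpa using hη.abs.const_mul 2
    filter_upwards [hη2.eventually (gt_mem_nhds hd)] with x hx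
    rw [Real.dist_eq, sub_zero, hb2]
    refine hd2 _ ⟨ht1 x, ht2 x⟩ _ ⟨Real.neg_one_le_sin _, Real.sin_le_one _⟩ ?_
    exact (hdist x).trans_lt hx
  · simpa using hη.abs
  · rw [add_sub_cancel, hb1, ht]
    exact (div_mul_cancel₀ _ (hpos x).ne').symm

/-- Behaviour at `-∞` of the real solutions built on `exp(2πi/3)`: a multiple of `La` plus a
modulated sine. -/
theorem exists_oscillation (hξ0 : 0 ≤ ξ) (hξ1 : ξ < 1) (β : ℝ) :
    ∃ η : ℝ → ℝ, Tendsto η atTop (𝓝 0) ∧ ∀ x : ℝ, 0 < x →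
      (Complex.exp (β * Complex.I) * airyMoment (-ξ) (cubeRoot * (-x : ℝ))).re =
        Real.cos (β - 2 * Real.pi / 3 * (1 - ξ)) * La ξ (-x) +
        √Real.pi * x ^ ((1 - ξ) / 2 - 3 / 4) *
          (Real.sin (2 / 3 * x ^ (3 / 2 : ℝ) + (5 * Real.pi / 12 - ξ * Real.pi / 6 - β)) +
            η x) := by
  have hpi : 0 < √Real.pi := Real.sqrt_pos.2 Real.pi_pos
  have hp0 : ((√Real.pi : ℝ) : ℂ) ≠ 0 := Complex.ofReal_ne_zero.2 hpi.ne'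
  -- `-γ` is the argument of the limit of the saddle point integral on the ray `arg q = π/6`
  set γ : ℝ := Real.pi / 6 / 2 + ξ * (Real.pi / 6) with hγ
  set q := Complex.exp ((Real.pi / 6 : ℝ) * Complex.I) with hq
  set W : ℝ → ℂ := fun x => Complex.exp (γ * Complex.I) / ((√Real.pi : ℝ) : ℂ) *
    (((x ^ (-((1 - ξ) / 2 - 3 / 4)) : ℝ) : ℂ) * saddleIntegral ξ ((√x : ℝ) * q)) with hW
  have hWlim : Tendsto W atTop (𝓝 1) := by
    have h := tendsto_saddleIntegral_sqrt hξ0 (q := q) (by rw [hq, cexp_pi_div_six]; simp)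
    rw [hq, gaussian_factor (by linarith [Real.pi_pos]) (by linarith [Real.pi_pos]), ← hq,
      ← hγ] at h
    have h2 := h.const_mul (Complex.exp (γ * Complex.I) / ((√Real.pi : ℝ) : ℂ))
    have e : Complex.exp (γ * Complex.I) * Complex.exp ((-γ : ℝ) * Complex.I) = 1 := by
      rw [← Complex.exp_add, ← Complex.exp_zero]; congr 1; push_cast; ring
    have e2 : Complex.exp (γ * Complex.I) / ((√Real.pi : ℝ) : ℂ) * ((√Real.pi : ℝ) *
        Complex.exp ((-γ : ℝ) * Complex.I)) = 1 := by
      rw [← e]; field_simp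
    rwa [e2] at h2
  set ψ : ℝ → ℝ := fun x => β + (Real.pi / 2 - Real.pi / 3 * (1 - ξ) - 2 / 3 * x ^ (3 / 2 : ℝ)) - γ
    with hψ
  refine ⟨fun x => (Complex.exp (ψ x * Complex.I) * (W x - 1)).re, ?_, fun x hx => ?_⟩
  · have h1 : Tendsto (fun x => ‖W x - 1‖) atTop (𝓝 0) := by
      simpa using (hWlim.sub_const 1).norm
    refine squeeze_zero_norm (fun x => ?_) h1
    refine (Complex.abs_re_le_norm _).trans ?_
    rw [norm_mul, Complex.norm_exp_ofReal_mul_I, one_mul]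
  · have hS : saddleIntegral ξ ((√x : ℝ) * q) = Complex.exp ((-γ : ℝ) * Complex.I) *
        ((√Real.pi * x ^ ((1 - ξ) / 2 - 3 / 4) : ℝ) : ℂ) * W x := by
      have e : Complex.exp (γ * Complex.I) * Complex.exp ((-γ : ℝ) * Complex.I) = 1 := by
        rw [← Complex.exp_add, ← Complex.exp_zero]; congr 1; push_cast; ring
      have hB : ((x ^ ((1 - ξ) / 2 - 3 / 4) : ℝ) : ℂ) ≠ 0 :=
        Complex.ofReal_ne_zero.2 (Real.rpow_pos_of_pos hx _).ne'
      simp only [hW]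
      rw [Real.rpow_neg hx.le, Complex.ofReal_inv, Complex.ofReal_mul]
      generalize ((x ^ ((1 - ξ) / 2 - 3 / 4) : ℝ) : ℂ) = B at hB
      generalize Complex.exp (γ * Complex.I) = E at e
      generalize Complex.exp ((-γ : ℝ) * Complex.I) = E' at e
      field_simp
      linear_combination (-saddleIntegral ξ ((√x : ℝ) * q)) * e
    rw [airyMoment_cubeRoot_neg hξ0 hξ1 hx, ← hq, hS, mul_add, ← mul_assoc, ← Complex.exp_add,
      ← add_mul, ← Complex.ofReal_add, Complex.add_re, Complex.re_mul_ofReal,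
      Complex.exp_ofReal_mul_I_re]
    have e1 : Complex.exp (β * Complex.I) *
        (Complex.exp ((Real.pi / 2 - Real.pi / 3 * (1 - ξ) - 2 / 3 * x ^ (3 / 2 : ℝ) : ℝ) *
          Complex.I) * (Complex.exp ((-γ : ℝ) * Complex.I) *
        ((√Real.pi * x ^ ((1 - ξ) / 2 - 3 / 4) : ℝ) : ℂ) * W x)) =
        ((√Real.pi * x ^ ((1 - ξ) / 2 - 3 / 4) : ℝ) : ℂ) * (Complex.exp (ψ x * Complex.I) +
          Complex.exp (ψ x * Complex.I) * (W x - 1)) := by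
      have : Complex.exp (ψ x * Complex.I) = Complex.exp (β * Complex.I) *
        Complex.exp ((Real.pi / 2 - Real.pi / 3 * (1 - ξ) - 2 / 3 * x ^ (3 / 2 : ℝ) : ℝ) *
          Complex.I) * Complex.exp ((-γ : ℝ) * Complex.I) := by
        rw [← Complex.exp_add, ← Complex.exp_add, hψ]; congr 1; push_cast; ring
      rw [this]; ring
    have e2 : Real.sin (2 / 3 * x ^ (3 / 2 : ℝ) + (5 * Real.pi / 12 - ξ * Real.pi / 6 - β)) =
        Real.cos (ψ x) := by
      rw [← Real.sin_pi_div_two_sub, hψ, hγ]; congr 1; ring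
    rw [e1, Complex.re_ofReal_mul, Complex.add_re, Complex.exp_ofReal_mul_I_re, e2]
    congr 2

/-- Passage from the additive form of a modulated sine at `-∞` to the form with an error inside
the phase and a relative error of the amplitude. -/
theorem exists_phase_form {f η : ℝ → ℝ} {A κ c : ℝ} (hη : Tendsto η atTop (𝓝 0))
    (hf : ∀ x : ℝ, 0 < x → f (-x) = A * x ^ κ *
      (Real.sin (2 / 3 * x ^ (3 / 2 : ℝ) + c) + η x)) :
    ∃ δ ε : ℝ → ℝ, (δ =o[atBot] fun θ : ℝ => (-θ) ^ (-(3 / 2) : ℝ)) ∧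
      Tendsto ε atBot (𝓝 0) ∧
      ∀ᶠ θ : ℝ in atBot, f θ = A * (-θ) ^ κ *
        Real.sin (2 / 3 * (-θ) ^ (3 / 2 : ℝ) * (1 + δ θ) + c) * (1 + ε θ) := by
  obtain ⟨w, ε, hw, hε, h⟩ := exists_phase_shift
    (fun θ : ℝ => 2 / 3 * (-θ) ^ (3 / 2 : ℝ) + c) (hη.comp tendsto_neg_atBot_atTop)
  refine ⟨fun θ => 3 / 2 * w θ * (-θ) ^ (-(3 / 2) : ℝ), ε, ?_, hε, ?_⟩
  · have h1 : (fun θ => 3 / 2 * w θ) =o[atBot] fun _ => (1 : ℝ) :=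
      (isLittleO_one_iff ℝ).2 (by simpa using hw.const_mul (3 / 2))
    simpa using h1.mul_isBigO (isBigO_refl (fun θ : ℝ => (-θ) ^ (-(3 / 2) : ℝ)) atBot)
  · filter_upwards [eventually_lt_atBot 0] with θ hθ
    have hx : 0 < -θ := by linarith
    have h2 := hf (-θ) hx
    have h3 := h θ
    simp only [Function.comp_apply] at h3
    rw [neg_neg, h3] at h2
    have e : 2 / 3 * (-θ) ^ (3 / 2 : ℝ) * (1 + 3 / 2 * w θ * (-θ) ^ (-(3 / 2) : ℝ)) + c =
        2 / 3 * (-θ) ^ (3 / 2 : ℝ) + c + w θ := by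
      have : (-θ) ^ (3 / 2 : ℝ) * (-θ) ^ (-(3 / 2) : ℝ) = 1 := by
        rw [← Real.rpow_add hx]; norm_num
      linear_combination w θ * this
    rw [e, h2]; ring

theorem exists_oscillation_Lb (hξ0 : 0 ≤ ξ) (hξ1 : ξ < 1) :
    ∃ η : ℝ → ℝ, Tendsto η atTop (𝓝 0) ∧ ∀ x : ℝ, 0 < x →
      Lb ξ (-x) = Real.sin (ξ * Real.pi) * La ξ (-x) +
        √Real.pi * x ^ ((1 - ξ) / 2 - 3 / 4) *
          (Real.sin (2 / 3 * x ^ (3 / 2 : ℝ) + (Real.pi / 4 - ξ * Real.pi / 2)) + η x) := by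
  obtain ⟨η, hη, h⟩ := exists_oscillation hξ0 hξ1 (Real.pi / 6 + ξ * Real.pi / 3)
  refine ⟨η, hη, fun x hx => ?_⟩
  rw [Lb_eq_re hξ0 hξ1, h x hx, ← Real.cos_pi_div_two_sub (ξ * Real.pi), ← Real.cos_neg]
  congr 2
  · congr 1; ring
  · congr 3; ring

theorem exists_oscillation_Lc (hξ0 : 0 ≤ ξ) (hξ1 : ξ < 1) :
    ∃ η : ℝ → ℝ, Tendsto η atTop (𝓝 0) ∧ ∀ x : ℝ, 0 < x →
      Lc ξ (-x) = √Real.pi * x ^ ((1 - ξ) / 2 - 3 / 4) *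
          (Real.sin (2 / 3 * x ^ (3 / 2 : ℝ) + (Real.pi / 4 + ξ * Real.pi / 2)) + η x) := by
  obtain ⟨η, hη, h⟩ := exists_oscillation hξ0 hξ1 (Real.pi / 6 - 2 * ξ * Real.pi / 3)
  refine ⟨η, hη, fun x hx => ?_⟩
  have h0 : Real.cos (Real.pi / 6 - 2 * ξ * Real.pi / 3 - 2 * Real.pi / 3 * (1 - ξ)) = 0 := by
    rw [← Real.cos_neg, ← Real.cos_pi_div_two]; congr 1; ring
  rw [Lc_eq_re hξ0 hξ1, h x hx, h0, zero_mul, zero_add]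
  congr 4; ring

/-- The Laplace-type integral `k ↦ ∫₀^∞ exp(-k u³/3 - u) u^s du` of the variable `k ≥ 0`, which
describes `La` near `-∞`. -/
def laplaceCube (s k : ℝ) : ℝ :=
  ∫ u in Ioi (0 : ℝ), Real.exp (-k * u ^ 3 / 3 - u) * u ^ s

theorem abs_exp_neg_sub_exp_neg_le {a b : ℝ} (ha : 0 ≤ a) (hb : 0 ≤ b) :
    |Real.exp (-a) - Real.exp (-b)| ≤ |a - b| := by
  wlog h : a ≤ b generalizing a b
  · rw [abs_sub_comm, abs_sub_comm a]; exact this hb ha (le_of_not_ge h)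
  have h1 : Real.exp (-b) ≤ Real.exp (-a) := Real.exp_le_exp.2 (by linarith)
  rw [abs_of_nonneg (by linarith), abs_of_nonpos (by linarith)]
  have h2 : Real.exp (-b) = Real.exp (-a) * Real.exp (-(b - a)) := by
    rw [← Real.exp_add]; congr 1; ring
  have h3 := Real.add_one_le_exp (-(b - a))
  have h4 : Real.exp (-a) ≤ 1 := Real.exp_le_one_iff.2 (by linarith)
  nlinarith [Real.exp_pos (-a)]

theorem integrableOn_laplaceCube {s k : ℝ} (hs : -1 < s) (hk : 0 ≤ k) :
    IntegrableOn (fun u : ℝ => Real.exp (-k * u ^ 3 / 3 - u) * u ^ s) (Ioi 0) := by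
  refine Integrable.mono' (integrableOn_exp_neg_mul_rpow hs 0) ?_ ?_
  · apply Measurable.aestronglyMeasurable; fun_prop
  · filter_upwards [ae_restrict_mem measurableSet_Ioi] with u hu
    have hu : 0 < u := hu
    rw [Real.norm_of_nonneg (by positivity)]
    gcongr
    have : 0 ≤ k * u ^ 3 := by positivity
    linarith

/-- The derivative is one-sided at `k = 0`; it again belongs to the family, which gives smoothness
up to the boundary by induction. -/
theorem hasDerivWithinAt_laplaceCube {s k : ℝ} (hs : -1 < s) (hk : 0 ≤ k) :
    HasDerivWithinAt (laplaceCube s) (-(1 / 3) * laplaceCube (s + 3) k) (Ici 0) k := by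
  rw [hasDerivWithinAt_iff_tendsto_slope]
  have hd : ∀ u : ℝ, HasDerivAt (fun k : ℝ => Real.exp (-k * u ^ 3 / 3 - u) * u ^ s)
      (-(1 / 3) * (Real.exp (-k * u ^ 3 / 3 - u) * (u ^ 3 * u ^ s))) k := fun u => by
    have := (((((hasDerivAt_id k).neg.mul_const (u ^ 3)).div_const 3).sub_const u).exp).mul_const
      (u ^ s)
    convert! this using 1
    simp only [id_eq, Pi.neg_apply]
    ring
  have hval : -(1 / 3) * laplaceCube (s + 3) k = ∫ u in Ioi (0 : ℝ),
      -(1 / 3) * (Real.exp (-k * u ^ 3 / 3 - u) * (u ^ 3 * u ^ s)) := by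
    rw [laplaceCube, ← integral_const_mul]
    refine setIntegral_congr_fun measurableSet_Ioi fun u hu => ?_
    have hu : 0 < u := hu
    rw [Real.rpow_add hu, show (3 : ℝ) = ((3 : ℕ) : ℝ) by norm_num, Real.rpow_natCast]
    ring
  have hslope : ∀ᶠ k' in 𝓝[Ici 0 \ {k}] k, ∫ u in Ioi (0 : ℝ),
      slope (fun k : ℝ => Real.exp (-k * u ^ 3 / 3 - u) * u ^ s) k k' =
      slope (laplaceCube s) k k' := by
    filter_upwards [self_mem_nhdsWithin] with k' hk'
    simp only [slope_def_field, laplaceCube]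
    rw [integral_div, integral_sub (integrableOn_laplaceCube hs hk'.1)
      (integrableOn_laplaceCube hs hk)]
  rw [hval]
  refine Tendsto.congr' hslope (tendsto_integral_filter_of_dominated_convergence
    (fun u => Real.exp (0 - u) * u ^ (s + 3)) ?_ ?_
    (integrableOn_exp_neg_mul_rpow (by linarith) 0) ?_)
  · refine Eventually.of_forall fun k' => ?_
    simp only [slope_def_field]
    apply Measurable.aestronglyMeasurable; fun_prop
  · filter_upwards [self_mem_nhdsWithin] with k' hk'
    filter_upwards [ae_restrict_mem measurableSet_Ioi] with u hu
    have hu : 0 < u := hu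
    have hk0 : 0 ≤ k' := hk'.1
    rw [slope_def_field, norm_div, Real.norm_eq_abs, Real.norm_eq_abs]
    refine div_le_of_le_mul₀ (abs_nonneg _) (by positivity) ?_
    have e : Real.exp (-k' * u ^ 3 / 3 - u) * u ^ s - Real.exp (-k * u ^ 3 / 3 - u) * u ^ s =
        (Real.exp (-(k' * u ^ 3 / 3)) - Real.exp (-(k * u ^ 3 / 3))) *
          (Real.exp (0 - u) * u ^ s) := by
      have : ∀ k : ℝ, Real.exp (-k * u ^ 3 / 3 - u) =
          Real.exp (-(k * u ^ 3 / 3)) * Real.exp (0 - u) := fun k => by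
        rw [← Real.exp_add]; congr 1; ring
      rw [this, this]; ring
    have h1 := abs_exp_neg_sub_exp_neg_le (a := k' * u ^ 3 / 3) (b := k * u ^ 3 / 3)
      (by positivity) (by positivity)
    have e2 : k' * u ^ 3 / 3 - k * u ^ 3 / 3 = (k' - k) * (u ^ 3 / 3) := by ring
    rw [e2, abs_mul, abs_of_pos (by positivity : 0 < u ^ 3 / 3)] at h1
    have h2 : u ^ (s + 3) = u ^ 3 * u ^ s := by
      rw [Real.rpow_add hu, show (3 : ℝ) = ((3 : ℕ) : ℝ) by norm_num, Real.rpow_natCast]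
      ring
    rw [e, abs_mul, abs_of_pos (by positivity : 0 < Real.exp (0 - u) * u ^ s), h2]
    calc _ ≤ |k' - k| * (u ^ 3 / 3) * (Real.exp (0 - u) * u ^ s) := by gcongr
      _ ≤ |k' - k| * u ^ 3 * (Real.exp (0 - u) * u ^ s) := by
        gcongr; have : 0 < u ^ 3 := by positivity
        linarith
      _ = _ := by ring
  · refine Eventually.of_forall fun u => ?_
    exact (hasDerivWithinAt_iff_tendsto_slope.1 (hd u).hasDerivWithinAt)

theorem contDiffOn_laplaceCube (n : ℕ) : ∀ {s : ℝ}, -1 < s →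
    ContDiffOn ℝ n (laplaceCube s) (Ici 0) := by
  induction n with
  | zero =>
    intro s hs
    exact contDiffOn_zero.2 fun k hk => (hasDerivWithinAt_laplaceCube hs hk).continuousWithinAt
  | succ n ih =>
    intro s hs
    rw [show ((n + 1 : ℕ) : WithTop ℕ∞) = (n : WithTop ℕ∞) + 1 by push_cast; rfl]
    refine (contDiffOn_succ_iff_derivWithin (uniqueDiffOn_Ici 0)).2
      ⟨fun k hk => (hasDerivWithinAt_laplaceCube hs hk).differentiableWithinAt, by simp, ?_⟩
    refine ContDiffOn.congr (contDiffOn_const.mul (ih (by linarith : -1 < s + 3))) (fun k hk => ?_)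
      (f := fun k => -(1 / 3) * laplaceCube (s + 3) k)
    exact (hasDerivWithinAt_laplaceCube hs hk).derivWithin (uniqueDiffOn_Ici 0 k hk)

theorem laplaceCube_zero (ξ : ℝ) (hξ1 : ξ < 1) : laplaceCube (-ξ) 0 = Real.Gamma (1 - ξ) := by
  rw [Real.Gamma_eq_integral (by linarith), laplaceCube]
  refine setIntegral_congr_fun measurableSet_Ioi fun u _ => ?_
  rw [show 1 - ξ - 1 = -ξ by ring]
  simp

/-- On the negative axis the moment depends on `x⁻³` alone, up to a power of `x`. -/
theorem airyMoment_neg_eq_laplaceCube (s : ℝ) {x : ℝ} (hx : 0 < x) :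
    ((x ^ (1 + s) : ℝ) : ℂ) * airyMoment s (-x) = (laplaceCube s (x⁻¹ ^ 3) : ℝ) := by
  rw [← neg_one_mul, airyMoment_scale s (-1) hx, laplaceCube, ← integral_complex_ofReal]
  refine setIntegral_congr_fun measurableSet_Ioi fun u _ => ?_
  rw [Complex.ofReal_mul, Complex.ofReal_exp]
  congr 2
  push_cast; ring

theorem La_neg_eq (ξ : ℝ) {x : ℝ} (hx : 0 < x) :
    La ξ (-x) = x ^ (-(1 - ξ)) * laplaceCube (-ξ) (x⁻¹ ^ 3) := by
  have h := airyMoment_neg_eq_laplaceCube (-ξ) hx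
  rw [← Complex.ofReal_neg, ← La_eq_airyMoment, ← Complex.ofReal_mul] at h
  rw [← Complex.ofReal_injective h, Real.rpow_neg hx.le, ← sub_eq_add_neg, inv_mul_cancel_left₀]
  exact (Real.rpow_pos_of_pos hx _).ne'

theorem analyticOnNhd_laplaceCube {s : ℝ} (hs : -1 < s) :
    AnalyticOnNhd ℝ (laplaceCube s) (Ioi 0) := by
  intro k hk
  have hk : 0 < k := hk
  -- for `k > 0` the integral is a rescaled value of the entire function `airyMoment s`
  set f : ℂ → ℂ := fun z => z ^ (-((1 + s) / 3 : ℝ) : ℂ) *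
    airyMoment s (-z ^ (-(1 / 3 : ℝ) : ℂ)) with hf
  have hdiff : DifferentiableOn ℂ f Complex.slitPlane := fun z hz => by
    have h1 : DifferentiableAt ℂ (fun z : ℂ => -z ^ (-(1 / 3 : ℝ) : ℂ)) z :=
      (differentiableAt_id.cpow_const hz).neg
    have h2 := ((hasDerivAt_airyMoment hs _).differentiableAt).comp z h1
    exact ((differentiableAt_id.cpow_const hz).mul h2).differentiableWithinAt
  have han := hdiff.analyticOnNhd Complex.isOpen_slitPlane (k : ℂ) (Or.inl (by simpa))
  refine han.re_ofReal.congr ?_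
  filter_upwards [lt_mem_nhds hk] with t ht
  set x := t ^ (-(1 / 3) : ℝ) with hx
  have hx0 : 0 < x := Real.rpow_pos_of_pos ht _
  have h := airyMoment_neg_eq_laplaceCube s hx0
  have e3 : x⁻¹ ^ 3 = t := by
    rw [hx, ← Real.rpow_neg ht.le, ← Real.rpow_natCast, ← Real.rpow_mul ht.le]; norm_num
  have e4 : x ^ (1 + s) = t ^ (-((1 + s) / 3)) := by
    rw [hx, ← Real.rpow_mul ht.le]; congr 1; ring
  rw [e3, e4, Complex.ofReal_cpow ht.le, hx, Complex.ofReal_cpow ht.le] at h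
  simp only [hf]
  rw [← Complex.ofReal_re (laplaceCube s t), ← h]
  congr 3
  · push_cast; rfl
  · push_cast; ring_nf

theorem tendsto_inv_cube_nhdsWithin :
    Tendsto (fun θ : ℝ => (-θ)⁻¹ ^ 3) atBot (𝓝[Ici (0 : ℝ)] 0) := by
  refine tendsto_nhdsWithin_iff.2 ⟨?_, ?_⟩
  · have := ((tendsto_inv_atTop_zero (𝕜 := ℝ)).comp tendsto_neg_atBot_atTop).pow 3
    simpa using this
  · filter_upwards [eventually_lt_atBot 0] with θ hθ
    have : 0 < -θ := by linarith
    have h : 0 < (-θ)⁻¹ ^ 3 := by positivity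
    exact h.le

theorem La_asymptotic_atBot (hξ1 : ξ < 1) :
    ∃ r : ℝ → ℝ, (r =O[atBot] fun θ : ℝ => θ ^ (-3 : ℤ)) ∧
      ∀ᶠ θ : ℝ in atBot,
        La ξ θ = (-θ) ^ (-(1 - ξ)) * Real.Gamma (1 - ξ) * (1 + r θ) := by
  have hG : Real.Gamma (1 - ξ) ≠ 0 := (Real.Gamma_pos_of_pos (by linarith)).ne'
  refine ⟨fun θ => (Real.Gamma (1 - ξ))⁻¹ *
    (laplaceCube (-ξ) ((-θ)⁻¹ ^ 3) - laplaceCube (-ξ) 0), ?_, ?_⟩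
  · have h := (hasDerivWithinAt_laplaceCube (by linarith : -1 < -ξ)
      le_rfl).differentiableWithinAt.isBigO_sub.comp_tendsto tendsto_inv_cube_nhdsWithin
    refine (h.const_mul_left _).trans (IsBigO.of_bound 1 (Eventually.of_forall fun θ => ?_))
    simp only [Function.comp_apply, sub_zero, one_mul]
    rw [zpow_neg, norm_inv]
    simp
  · filter_upwards [eventually_lt_atBot 0] with θ hθ
    have := La_neg_eq ξ (by linarith : 0 < -θ)
    rw [neg_neg] at this
    rw [this, laplaceCube_zero ξ hξ1]
    field_simp
    ring

end

/-! ### Non-oscillation, linear independence and the solution space -/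

noncomputable section

variable {ξ : ℝ}

theorem hasDerivAt_La (hξ1 : ξ < 1) (θ : ℝ) :
    HasDerivAt (La ξ) (airyMoment (-ξ + 1) θ).re θ := by
  have h := hasDerivAt_re_airyMoment (by linarith : -1 < -ξ) 1 1 θ
  simp only [one_mul] at h
  have e : La ξ = fun θ : ℝ => (airyMoment (-ξ) θ).re := by
    ext θ; rw [← La_eq_airyMoment, Complex.ofReal_re]
  rwa [e]

theorem abs_airyMoment_neg_le {s : ℝ} (hs : -1 < s) {x : ℝ} (hx : 0 < x) :
    ‖airyMoment s (-x : ℝ)‖ ≤ x ^ (-(1 + s)) * laplaceCube s 0 := by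
  have h := airyMoment_scale s (-1) hx
  have e1 : (-1 : ℂ) * x = ((-x : ℝ) : ℂ) := by push_cast; ring
  rw [e1] at h
  have hpos : 0 < x ^ (1 + s) := Real.rpow_pos_of_pos hx _
  have h2 : x ^ (1 + s) * ‖airyMoment s (-x : ℝ)‖ ≤ laplaceCube s 0 := by
    have e3 : x ^ (1 + s) * ‖airyMoment s (-x : ℝ)‖ =
        ‖((x ^ (1 + s) : ℝ) : ℂ) * airyMoment s (-x : ℝ)‖ := by
      rw [norm_mul, Complex.norm_real, Real.norm_of_nonneg hpos.le]
    rw [e3, h]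
    refine norm_integral_le_of_norm_le (integrableOn_laplaceCube hs le_rfl) ?_
    filter_upwards [ae_restrict_mem measurableSet_Ioi] with u hu
    have hu : 0 < u := hu
    rw [norm_mul, Complex.norm_real, Real.norm_of_nonneg (by positivity), Complex.norm_exp]
    refine mul_le_mul_of_nonneg_right (Real.exp_le_exp.2 ?_) (by positivity)
    have e : -((x⁻¹ ^ 3 : ℝ) : ℂ) * u ^ 3 / 3 + -1 * u =
        ((-(x⁻¹ ^ 3) * u ^ 3 / 3 - u : ℝ) : ℂ) := by push_cast; ring
    rw [e, Complex.ofReal_re]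
    have : 0 ≤ x⁻¹ ^ 3 * u ^ 3 := by positivity
    linarith
  rw [Real.rpow_neg hx.le, ← div_eq_inv_mul, le_div_iff₀ hpos, mul_comm]
  exact h2

/-- The derivative of `La` is of order `x^(ξ-2)`, one power smaller than `La`. -/
theorem abs_La_sub_le (hξ1 : ξ < 1) {x x' : ℝ} (hx : 0 < x) (hxx' : x ≤ x') :
    |La ξ (-x') - La ξ (-x)| ≤ x ^ (-(2 - ξ)) * laplaceCube (-ξ + 1) 0 * (x' - x) := by
  have hG : 0 ≤ laplaceCube (-ξ + 1) 0 :=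
    setIntegral_nonneg measurableSet_Ioi fun u hu => by
      have hu : 0 < u := hu
      positivity
  have h := Convex.norm_image_sub_le_of_norm_hasDerivWithin_le (s := Icc (-x') (-x))
    (f := La ξ) (f' := fun θ : ℝ => (airyMoment (-ξ + 1) θ).re)
    (C := x ^ (-(2 - ξ)) * laplaceCube (-ξ + 1) 0) (x := -x) (y := -x')
    (fun θ _ => (hasDerivAt_La hξ1 θ).hasDerivWithinAt) (fun θ hθ => ?_) (convex_Icc _ _)
    ⟨by linarith, le_rfl⟩ ⟨le_rfl, by linarith⟩
  · refine h.trans (le_of_eq ?_)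
    rw [Real.norm_eq_abs, show -x' - -x = -(x' - x) by ring, abs_neg, abs_of_nonneg (by linarith)]
  · have hθx : x ≤ -θ := by linarith [hθ.2]
    refine (Complex.abs_re_le_norm _).trans ?_
    have h1 := abs_airyMoment_neg_le (by linarith : -1 < -ξ + 1) (hx.trans_le hθx)
    rw [neg_neg, show 1 + (-ξ + 1) = 2 - ξ by ring] at h1
    refine h1.trans (mul_le_mul_of_nonneg_right ?_ hG)
    exact Real.rpow_le_rpow_of_nonpos hx hθx (by linarith)

/-- The point of the negative axis, up to sign, at which the phase `2/3 x^(3/2)` equals `t`. -/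
def phasePoint (t : ℝ) : ℝ := (3 / 2 * t) ^ (2 / 3 : ℝ)

theorem phasePoint_pos {t : ℝ} (ht : 0 < t) : 0 < phasePoint t :=
  Real.rpow_pos_of_pos (by positivity) _

theorem phasePoint_phase {t : ℝ} (ht : 0 ≤ t) : 2 / 3 * phasePoint t ^ (3 / 2 : ℝ) = t := by
  rw [phasePoint, ← Real.rpow_mul (by positivity)]
  norm_num
  ring

theorem phasePoint_le {t t' : ℝ} (ht : 0 ≤ t) (h : t ≤ t') : phasePoint t ≤ phasePoint t' :=
  Real.rpow_le_rpow (by positivity) (by linarith) (by norm_num)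

theorem phasePoint_sub_le {t t' : ℝ} (ht : 0 < t) (h : t ≤ t') :
    phasePoint t' - phasePoint t ≤ 3 / 2 * (t' - t) * phasePoint t ^ (-(1 / 2) : ℝ) := by
  have hx := phasePoint_pos ht
  have hx' := phasePoint_pos (ht.trans_le h)
  have e : ∀ x : ℝ, 0 < x → x ^ (3 / 2 : ℝ) = x * x ^ (1 / 2 : ℝ) := fun x hx => by
    nth_rewrite 2 [← Real.rpow_one x]
    rw [← Real.rpow_add hx]; norm_num
  have h1 := phasePoint_phase ht.le
  have h2 := phasePoint_phase (ht.le.trans h)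
  rw [e _ hx] at h1
  rw [e _ hx'] at h2
  have h3 : phasePoint t ^ (1 / 2 : ℝ) ≤ phasePoint t' ^ (1 / 2 : ℝ) :=
    Real.rpow_le_rpow hx.le (phasePoint_le ht.le h) (by norm_num)
  rw [Real.rpow_neg hx.le, ← div_eq_mul_inv, le_div_iff₀ (Real.rpow_pos_of_pos hx _)]
  nlinarith [mul_le_mul_of_nonneg_left h3 hx'.le]

theorem tendsto_phasePoint : Tendsto phasePoint atTop atTop :=
  (tendsto_rpow_atTop (by norm_num)).comp (tendsto_id.const_mul_atTop (by norm_num))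

theorem tendsto_phasePoint_ratio (κ : ℝ) :
    Tendsto (fun t => phasePoint (t + Real.pi) ^ κ / phasePoint t ^ κ) atTop (𝓝 1) := by
  have h1 : Tendsto (fun t : ℝ => 1 + Real.pi * t⁻¹) atTop (𝓝 (1 + Real.pi * 0)) :=
    (tendsto_inv_atTop_zero.const_mul Real.pi).const_add 1
  rw [mul_zero, add_zero] at h1
  have h2 := (Real.continuousAt_rpow_const (1 : ℝ) (2 / 3 * κ) (Or.inl one_ne_zero)).tendsto.comp h1
  rw [Real.one_rpow] at h2
  refine h2.congr' ?_
  filter_upwards [eventually_gt_atTop 0] with t ht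
  have hp := Real.pi_pos
  simp only [Function.comp_apply, phasePoint]
  rw [← Real.rpow_mul (by positivity), ← Real.rpow_mul (by positivity),
    ← Real.div_rpow (by positivity) (by positivity)]
  congr 1
  field_simp

/-- If `d n` has a constant sign while `(-1)^n d n` converges, the limit is zero. -/
theorem eq_zero_of_tendsto_alternating {d : ℕ → ℝ} {L : ℝ}
    (h : Tendsto (fun n => (-1) ^ n * d n) atTop (𝓝 L)) (hd : ∀ᶠ n in atTop, d n ≤ 0) : L = 0 := by
  have hev : Tendsto (fun m : ℕ => 2 * m) atTop atTop :=
    tendsto_id.const_mul_atTop' (by norm_num)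
  have hodd : Tendsto (fun m : ℕ => 2 * m + 1) atTop atTop :=
    tendsto_atTop_mono (fun m => Nat.le_succ _) hev
  refine le_antisymm ?_ ?_
  · refine le_of_tendsto (h.comp hev) ?_
    filter_upwards [hev.eventually hd] with m hm
    simpa [pow_mul] using hm
  · refine ge_of_tendsto (h.comp hodd) ?_
    filter_upwards [hodd.eventually hd] with m hm
    simpa [pow_succ, pow_mul] using hm

/-- Between consecutive points at which the phase takes the values `s + n π`, a combination of
the three functions changes, relative to the amplitude of the oscillation, by an alternating
quantity: the contribution of `La` to the increment is of lower order. -/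
theorem tendsto_increment (hξ0 : 0 < ξ) (hξ1 : ξ < 1) (a b c : ℝ) {s : ℝ} (hs : 0 < s) :
    Tendsto (fun n : ℕ => (-1) ^ n *
      ((a * La ξ (-phasePoint (s + n * Real.pi + Real.pi)) +
        b * Lb ξ (-phasePoint (s + n * Real.pi + Real.pi)) +
        c * Lc ξ (-phasePoint (s + n * Real.pi + Real.pi)) -
      (a * La ξ (-phasePoint (s + n * Real.pi)) + b * Lb ξ (-phasePoint (s + n * Real.pi)) +
        c * Lc ξ (-phasePoint (s + n * Real.pi)))) /
        phasePoint (s + n * Real.pi) ^ ((1 - ξ) / 2 - 3 / 4))) atTop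
      (𝓝 (-2 * √Real.pi * (b * Real.sin (s + (Real.pi / 4 - ξ * Real.pi / 2)) +
        c * Real.sin (s + (Real.pi / 4 + ξ * Real.pi / 2))))) := by
  obtain ⟨ηb, hηb, hb⟩ := exists_oscillation_Lb hξ0.le hξ1
  obtain ⟨ηc, hηc, hc⟩ := exists_oscillation_Lc hξ0.le hξ1
  set κ := (1 - ξ) / 2 - 3 / 4 with hκ
  set A := a + b * Real.sin (ξ * Real.pi) with hA
  set f := b * Real.sin (s + (Real.pi / 4 - ξ * Real.pi / 2)) +
        c * Real.sin (s + (Real.pi / 4 + ξ * Real.pi / 2)) with hf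
  set G := laplaceCube (-ξ + 1) 0 with hG
  have hp := Real.pi_pos
  have ht : Tendsto (fun n : ℕ => s + n * Real.pi) atTop atTop :=
    tendsto_atTop_add_const_left _ _ (tendsto_natCast_atTop_atTop.atTop_mul_const hp)
  have ht' : Tendsto (fun n : ℕ => s + n * Real.pi + Real.pi) atTop atTop :=
    tendsto_atTop_add_const_right _ _ ht
  have htpos : ∀ n : ℕ, 0 < s + n * Real.pi := fun n => by positivity
  set η : ℝ → ℝ := fun x => b * ηb x + c * ηc x with hη
  have hηlim : Tendsto η atTop (𝓝 0) := by
    simpa using (hηb.const_mul b).add (hηc.const_mul c)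
  -- the sign `(-1)^n` is bounded
  have hsign : ∀ {g : ℕ → ℝ}, Tendsto g atTop (𝓝 0) →
      Tendsto (fun n : ℕ => (-1) ^ n * g n) atTop (𝓝 0) := fun {g} hg => by
    refine squeeze_zero_norm (fun n => ?_) (by simpa using hg.norm)
    rw [norm_mul, norm_pow, norm_neg, norm_one, one_pow, one_mul, Real.norm_eq_abs]
  have hη1 := hsign (hηlim.comp (tendsto_phasePoint.comp ht))
  have hη2 := hsign (hηlim.comp (tendsto_phasePoint.comp ht'))
  have hratio := (tendsto_phasePoint_ratio κ).comp ht
  -- the increment of `La` is `O(x^(ξ-2) x^(-1/2))`, which is `x^κ` times `x^(-(9/4 - 3ξ/2))`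
  have hLa : Tendsto (fun n : ℕ => (-1) ^ n * (A *
      ((La ξ (-phasePoint (s + n * Real.pi + Real.pi)) - La ξ (-phasePoint (s + n * Real.pi))) /
        phasePoint (s + n * Real.pi) ^ κ))) atTop (𝓝 0) := by
    apply hsign
    have h1 : Tendsto (fun t => phasePoint t ^ (-(9 / 4 - 3 / 2 * ξ))) atTop (𝓝 0) :=
      (tendsto_rpow_neg_atTop (by linarith)).comp tendsto_phasePoint
    have h2 : Tendsto (fun n : ℕ => G * (3 / 2 * Real.pi) *
        phasePoint (s + n * Real.pi) ^ (-(9 / 4 - 3 / 2 * ξ))) atTop (𝓝 0) := by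
      simpa using (h1.comp ht).const_mul (G * (3 / 2 * Real.pi))
    have h3 : Tendsto (fun n : ℕ => (La ξ (-phasePoint (s + n * Real.pi + Real.pi)) -
      La ξ (-phasePoint (s + n * Real.pi))) / phasePoint (s + n * Real.pi) ^ κ) atTop (𝓝 0) := by
      refine squeeze_zero_norm (fun n => ?_) h2
      set x := phasePoint (s + n * Real.pi) with hx
      have hx0 : 0 < x := phasePoint_pos (htpos n)
      have hxκ : 0 < x ^ κ := Real.rpow_pos_of_pos hx0 _
      have hle : s + n * Real.pi ≤ s + n * Real.pi + Real.pi := by linarith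
      have i1 := abs_La_sub_le hξ1 hx0 (phasePoint_le (htpos n).le hle)
      have i2 := phasePoint_sub_le (htpos n) hle
      rw [← hx, add_sub_cancel_left] at i2
      have hG0 : 0 ≤ G := setIntegral_nonneg measurableSet_Ioi fun u hu => by
        have hu : 0 < u := hu
        positivity
      rw [norm_div, Real.norm_eq_abs, Real.norm_of_nonneg hxκ.le, div_le_iff₀ hxκ]
      refine i1.trans ((mul_le_mul_of_nonneg_left i2 (by positivity)).trans (le_of_eq ?_))
      have e : x ^ (-(2 - ξ)) * x ^ (-(1 / 2) : ℝ) = x ^ (-(9 / 4 - 3 / 2 * ξ)) * x ^ κ := by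
        rw [← Real.rpow_add hx0, ← Real.rpow_add hx0]
        congr 1; rw [hκ]; ring
      linear_combination (G * (3 / 2 * Real.pi)) * e
    simpa using h3.const_mul A
  have hlim := hLa.add (((hratio.mul (hη2.const_add (-f))).sub (hη1.const_add f)).const_mul
    √Real.pi)
  have e0 : 0 + √Real.pi * (1 * (-f + 0) - (f + 0)) = -2 * √Real.pi * f := by ring
  rw [e0] at hlim
  refine hlim.congr fun n => ?_
  -- at phase `s + m π` both sines equal `(-1)^m` times their value at `s`
  have hval : ∀ (m : ℕ) (t : ℝ), 0 < t → t = s + m * Real.pi →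
      a * La ξ (-phasePoint t) + b * Lb ξ (-phasePoint t) + c * Lc ξ (-phasePoint t) =
      A * La ξ (-phasePoint t) +
        √Real.pi * phasePoint t ^ κ * ((-1) ^ m * f + η (phasePoint t)) := fun m t ht0 hm => by
    have hx0 := phasePoint_pos ht0
    rw [hb _ hx0, hc _ hx0, phasePoint_phase ht0.le]
    have e1 : ∀ d : ℝ, Real.sin (t + d) = (-1) ^ m * Real.sin (s + d) := fun d => by
      rw [hm, show s + m * Real.pi + d = s + d + m * Real.pi by ring, Real.sin_add_nat_mul_pi]
    rw [e1, e1, hA, hf, hη]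
    ring
  have hx0 : phasePoint (s + n * Real.pi) ^ κ ≠ 0 :=
    (Real.rpow_pos_of_pos (phasePoint_pos (htpos n)) _).ne'
  rw [hval n _ (htpos n) rfl, hval (n + 1) (s + n * Real.pi + Real.pi) (by linarith [htpos n])
    (by push_cast; ring)]
  simp only [Function.comp_apply]
  have hsq : ((-1 : ℝ) ^ n) * (-1) ^ n = 1 := by rw [← mul_pow]; norm_num
  rw [pow_succ]
  generalize (-1 : ℝ) ^ n = σ at hsq
  field_simp
  linear_combination (√Real.pi * f * (phasePoint (s + n * Real.pi + Real.pi) ^ κ +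
    phasePoint (s + n * Real.pi) ^ κ)) * hsq

/-- Along the points at which the phase is `s + n π` the increments of a monotone function have a
constant sign, whereas those of the combination alternate unless the limit vanishes. Varying the
offset `s` eliminates both oscillating terms, as `sin(ξπ)` does not vanish. -/
theorem coeff_eq_zero_of_nonOscillatory (hξ0 : 0 < ξ) (hξ1 : ξ < 1) {a b c : ℝ} {y : ℝ → ℝ}
    (hy : ∀ θ, y θ = a * La ξ θ + b * Lb ξ θ + c * Lc ξ θ) (h : NonOscillatoryAtBot y) :
    b = 0 ∧ c = 0 := by
  have hp := Real.pi_pos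
  have hsin : 0 < Real.sin (ξ * Real.pi) :=
    Real.sin_pos_of_pos_of_lt_pi (by positivity) (by nlinarith)
  have hpi : 0 < √Real.pi := Real.sqrt_pos.2 hp
  have key : ∀ s : ℝ, 0 < s → b * Real.sin (s + (Real.pi / 4 - ξ * Real.pi / 2)) +
        c * Real.sin (s + (Real.pi / 4 + ξ * Real.pi / 2)) = 0 := by
    intro s hs
    have hlim := tendsto_increment hξ0 hξ1 a b c hs
    simp only [← hy] at hlim
    have htpos : ∀ n : ℕ, 0 < s + n * Real.pi := fun n => by positivity
    have ht : Tendsto (fun n : ℕ => s + n * Real.pi) atTop atTop :=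
      tendsto_atTop_add_const_left _ _ (tendsto_natCast_atTop_atTop.atTop_mul_const hp)
    have hzero : -2 * √Real.pi * (b * Real.sin (s + (Real.pi / 4 - ξ * Real.pi / 2)) +
        c * Real.sin (s + (Real.pi / 4 + ξ * Real.pi / 2))) = 0 := by
      obtain ⟨T, hT⟩ := h
      have hev := (tendsto_phasePoint.comp ht).eventually_ge_atTop (-T)
      have hmem : ∀ n : ℕ, -T ≤ phasePoint (s + n * Real.pi) →
          -phasePoint (s + n * Real.pi + Real.pi) ∈ Iic T ∧
          -phasePoint (s + n * Real.pi) ∈ Iic T ∧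
          -phasePoint (s + n * Real.pi + Real.pi) ≤ -phasePoint (s + n * Real.pi) := fun n hn => by
        have := phasePoint_le (htpos n).le (by linarith : s + n * Real.pi ≤
          s + n * Real.pi + Real.pi)
        refine ⟨?_, ?_, by linarith⟩
        · simp only [mem_Iic]; linarith
        · simp only [mem_Iic]; linarith
      rcases hT with hT | hT
      · refine eq_zero_of_tendsto_alternating hlim ?_
        filter_upwards [hev] with n hn
        obtain ⟨h1, h2, h3⟩ := hmem n hn
        exact div_nonpos_of_nonpos_of_nonneg (by linarith [hT h1 h2 h3])
          (Real.rpow_nonneg (phasePoint_pos (htpos n)).le _)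
      · have hlim' := hlim.neg
        simp only [← mul_neg] at hlim'
        refine neg_eq_zero.1 ((by ring_nf : _ = _).trans
          (eq_zero_of_tendsto_alternating hlim' ?_))
        filter_upwards [hev] with n hn
        obtain ⟨h1, h2, h3⟩ := hmem n hn
        exact neg_nonpos.2 (div_nonneg (by linarith [hT h1 h2 h3])
          (Real.rpow_nonneg (phasePoint_pos (htpos n)).le _))
    have : -2 * √Real.pi ≠ 0 := mul_ne_zero (by norm_num) hpi.ne'
    exact (mul_eq_zero.1 hzero).resolve_left this
  -- each offset makes one of the two sines vanish; the multiple `2π` only keeps it positive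
  constructor
  · have h1 := key (2 * Real.pi - Real.pi / 4 - ξ * Real.pi / 2) (by nlinarith)
    have e1 : 2 * Real.pi - Real.pi / 4 - ξ * Real.pi / 2 + (Real.pi / 4 - ξ * Real.pi / 2) =
        2 * Real.pi - ξ * Real.pi := by ring
    have e2 : 2 * Real.pi - Real.pi / 4 - ξ * Real.pi / 2 + (Real.pi / 4 + ξ * Real.pi / 2) =
        2 * Real.pi := by ring
    rw [e1, e2, Real.sin_two_pi, Real.sin_two_pi_sub, mul_zero, add_zero] at h1
    rcases mul_eq_zero.1 h1 with h1 | h1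
    · exact h1
    · linarith
  · have h1 := key (2 * Real.pi - Real.pi / 4 + ξ * Real.pi / 2) (by nlinarith)
    have e1 : 2 * Real.pi - Real.pi / 4 + ξ * Real.pi / 2 + (Real.pi / 4 - ξ * Real.pi / 2) =
        2 * Real.pi := by ring
    have e2 : 2 * Real.pi - Real.pi / 4 + ξ * Real.pi / 2 + (Real.pi / 4 + ξ * Real.pi / 2) =
        ξ * Real.pi + 2 * Real.pi := by ring
    rw [e1, e2, Real.sin_two_pi, Real.sin_add_two_pi, mul_zero, zero_add] at h1
    exact (mul_eq_zero.1 h1).resolve_right hsin.ne'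

theorem La_pos (hξ1 : ξ < 1) (θ : ℝ) : 0 < La ξ θ := by
  refine (setIntegral_pos_iff_support_of_nonneg_ae ?_ (integrableOn_laIntegrand hξ1 θ)).2 ?_
  · filter_upwards [ae_restrict_mem measurableSet_Ioi] with τ hτ
    have hτ : 0 < τ := hτ
    exact mul_nonneg (Real.exp_nonneg _) (Real.rpow_nonneg hτ.le _)
  · have : Function.support (laIntegrand ξ θ) ∩ Ioi 0 = Ioi 0 := by
      refine inter_eq_right.2 fun τ hτ => ?_
      exact (mul_pos (Real.exp_pos _) (Real.rpow_pos_of_pos hτ _)).ne'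
    rw [this, Real.volume_Ioi]
    exact ENNReal.zero_lt_top

theorem La_monotone (hξ1 : ξ < 1) : Monotone (La ξ) := by
  intro θ θ' h
  refine setIntegral_mono_on (integrableOn_laIntegrand hξ1 θ) (integrableOn_laIntegrand hξ1 θ')
    measurableSet_Ioi fun τ hτ => ?_
  have hτ : 0 < τ := hτ
  unfold laIntegrand
  gcongr

theorem nonOscillatoryAtBot_smul_La (hξ1 : ξ < 1) (a : ℝ) : NonOscillatoryAtBot (a • La ξ) := by
  refine ⟨0, ?_⟩
  rcases le_total 0 a with ha | ha
  · left
    intro x _ y _ hxy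
    exact mul_le_mul_of_nonneg_left (La_monotone hξ1 hxy) ha
  · right
    intro x _ y _ hxy
    exact mul_le_mul_of_nonpos_left (La_monotone hξ1 hxy) ha

/-- The zero function is monotone, so a vanishing combination has no oscillating part. -/
theorem linearIndependent_La_Lb_Lc (hξ0 : 0 < ξ) (hξ1 : ξ < 1) :
    LinearIndependent ℝ ![La ξ, Lb ξ, Lc ξ] := by
  rw [Fintype.linearIndependent_iff]
  intro g hg
  have hg' : ∀ θ, (0 : ℝ) = g 0 * La ξ θ + g 1 * Lb ξ θ + g 2 * Lc ξ θ := fun θ => by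
    have := congrFun hg θ
    simp [Fin.sum_univ_three] at this
    exact this.symm
  obtain ⟨h1, h2⟩ := coeff_eq_zero_of_nonOscillatory hξ0 hξ1 (y := fun _ => 0) hg'
    ⟨0, Or.inl fun _ _ _ _ _ => le_rfl⟩
  have h0 : g 0 = 0 := by
    have := hg' 0
    rw [h1, h2, zero_mul, zero_mul, add_zero, add_zero] at this
    exact (mul_eq_zero.1 this.symm).resolve_right (La_pos hξ1 0).ne'
  intro i
  fin_cases i
  · exact h0
  · exact h1
  · exact h2

theorem isSolution_La (hξ1 : ξ < 1) : IsSolution ξ (La ξ) := by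
  have h := isSolution_re_airyMoment hξ1 1 (one_pow 3)
  have e : La ξ = fun θ : ℝ => (1 * airyMoment (-ξ) (1 * θ)).re := by
    ext θ; rw [one_mul, one_mul, ← La_eq_airyMoment, Complex.ofReal_re]
  rwa [e]

theorem isSolution_Lb (hξ0 : 0 ≤ ξ) (hξ1 : ξ < 1) : IsSolution ξ (Lb ξ) := by
  rw [show Lb ξ = _ from funext (Lb_eq_re hξ0 hξ1)]
  exact isSolution_re_airyMoment hξ1 _ cubeRoot_pow_three

theorem isSolution_Lc (hξ0 : 0 ≤ ξ) (hξ1 : ξ < 1) : IsSolution ξ (Lc ξ) := by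
  rw [show Lc ξ = _ from funext (Lc_eq_re hξ0 hξ1)]
  exact isSolution_re_airyMoment hξ1 _ cubeRoot_pow_three

/-- The vector space of solutions of Langer's equation. -/
def solutionSpace (ξ : ℝ) : Submodule ℝ (ℝ → ℝ) where
  carrier := {y | IsSolution ξ y}
  zero_mem' := by
    refine ⟨contDiff_const, fun θ => ?_⟩
    simp
  add_mem' := by
    rintro y z ⟨hy, hy'⟩ ⟨hz, hz'⟩
    refine ⟨hy.add hz, fun θ => ?_⟩
    rw [iteratedDeriv_add hy.contDiffAt hz.contDiffAt,
      deriv_add (hy.differentiable (by norm_num) θ) (hz.differentiable (by norm_num) θ), hy', hz',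
      Pi.add_apply]
    ring
  smul_mem' := by
    rintro a y ⟨hy, hy'⟩
    refine ⟨hy.const_smul a, fun θ => ?_⟩
    rw [iteratedDeriv_const_smul hy.contDiffAt,
      deriv_const_smul _ (hy.differentiable (by norm_num) θ), hy', Pi.smul_apply]
    simp only [smul_eq_mul]
    ring

theorem IsSolution.hasDerivAt {y : ℝ → ℝ} (hy : IsSolution ξ y) {m : ℕ} (hm : m < 3) (t : ℝ) :
    HasDerivAt (iteratedDeriv m y) (iteratedDeriv (m + 1) y t) t := by
  rw [iteratedDeriv_succ]
  exact (hy.1.differentiable_iteratedDeriv m (by exact_mod_cast hm) t).hasDerivAt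

/-- Uniqueness for the initial value problem at `0`. -/
theorem IsSolution.eq_zero {y : ℝ → ℝ} (hy : IsSolution ξ y)
    (h : ∀ m < 3, iteratedDeriv m y 0 = 0) : y = 0 := by
  ext t
  -- the first order system for `(y, y', y'')` is Lipschitz on bounded intervals
  set M := |t| + 1 with hM
  have hM0 : 0 ≤ M := by positivity
  set v : ℝ → ℝ × ℝ × ℝ → ℝ × ℝ × ℝ := fun t p => (p.2.1, p.2.2, t * p.2.1 + (1 - ξ) * p.1) with hv
  have hLip : ∀ t ∈ Ioo (-M) M, LipschitzOnWith (M + |1 - ξ| + 1).toNNReal (v t) univ := by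
    intro t ht
    refine LipschitzOnWith.of_dist_le_mul fun p _ q _ => ?_
    rw [Real.coe_toNNReal _ (by positivity), dist_eq_norm, dist_eq_norm]
    have e : v t p - v t q = v t (p - q) := by
      simp only [hv, Prod.mk_sub_mk, Prod.fst_sub, Prod.snd_sub, Prod.mk.injEq, true_and]
      ring
    rw [e]
    generalize p - q = w
    have h1 : ‖w.1‖ ≤ ‖w‖ := norm_fst_le w
    have h2 : ‖w.2.1‖ ≤ ‖w‖ := (norm_fst_le w.2).trans (norm_snd_le w)
    have h3 : ‖w.2.2‖ ≤ ‖w‖ := (norm_snd_le w.2).trans (norm_snd_le w)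
    have hw := norm_nonneg w
    have hx : 0 ≤ |1 - ξ| := abs_nonneg _
    have ht' : |t| ≤ M := abs_le.2 ⟨ht.1.le, ht.2.le⟩
    have hbase : ‖w‖ ≤ (M + |1 - ξ| + 1) * ‖w‖ := by nlinarith [mul_nonneg hM0 hw, mul_nonneg hx hw]
    refine max_le (h2.trans hbase) (max_le (h3.trans hbase) ?_)
    refine (norm_add_le _ _).trans ?_
    rw [norm_mul, norm_mul, Real.norm_eq_abs t, Real.norm_eq_abs (1 - ξ)]
    have i1 : |t| * ‖w.2.1‖ ≤ M * ‖w‖ := mul_le_mul ht' h2 (norm_nonneg _) hM0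
    have i2 : |1 - ξ| * ‖w.1‖ ≤ |1 - ξ| * ‖w‖ := mul_le_mul_of_nonneg_left h1 hx
    change |t| * ‖w.2.1‖ + |1 - ξ| * ‖w.1‖ ≤ _
    linarith
  have hderiv : ∀ t, HasDerivAt
      (fun t => (iteratedDeriv 0 y t, iteratedDeriv 1 y t, iteratedDeriv 2 y t))
      (v t (iteratedDeriv 0 y t, iteratedDeriv 1 y t, iteratedDeriv 2 y t)) t := fun t => by
    have h3 := hy.hasDerivAt (m := 2) (by norm_num) t
    have e := hy.2 t
    rw [← iteratedDeriv_one] at e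
    rw [show 2 + 1 = 3 from rfl, e] at h3
    have := (hy.hasDerivAt (m := 0) (by norm_num) t).prodMk
      ((hy.hasDerivAt (m := 1) (by norm_num) t).prodMk h3)
    simpa [hv] using this
  have hzero : ∀ t, HasDerivAt (fun _ : ℝ => (0 : ℝ × ℝ × ℝ)) (v t 0) t := fun t => by
    have : v t 0 = 0 := by simp [hv]
    rw [this]
    exact hasDerivAt_const t _
  have htM : t ∈ Icc (-M) M := by
    refine abs_le.1 ?_
    rw [hM]; linarith
  have := ODE_solution_unique_of_mem_Icc hLip (t₀ := 0)
    ⟨by rw [hM]; linarith [abs_nonneg t], by rw [hM]; linarith [abs_nonneg t]⟩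
    (fun t _ => (hderiv t).continuousAt.continuousWithinAt) (fun t _ => hderiv t)
    (fun _ _ => mem_univ _) continuousOn_const (fun t _ => hzero t) (fun _ _ => mem_univ _)
    (by simp only [h 0 (by norm_num), h 1 (by norm_num), h 2 (by norm_num)]; rfl) htM
  have h0 := congrArg Prod.fst this
  simpa using h0

/-- The initial data at `0` of a solution. -/
def initialData (ξ : ℝ) : solutionSpace ξ →ₗ[ℝ] (Fin 3 → ℝ) where
  toFun y := fun m => iteratedDeriv m (y : ℝ → ℝ) 0
  map_add' y z := by
    ext m
    have hm : ((m : ℕ) : WithTop ℕ∞) ≤ 3 := by exact_mod_cast m.2.le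
    exact iteratedDeriv_add (y.2.1.of_le hm).contDiffAt (z.2.1.of_le hm).contDiffAt
  map_smul' a y := by
    ext m
    have hm : ((m : ℕ) : WithTop ℕ∞) ≤ 3 := by exact_mod_cast m.2.le
    exact iteratedDeriv_const_smul (y.2.1.of_le hm).contDiffAt a

theorem initialData_injective (ξ : ℝ) : Function.Injective (initialData ξ) := by
  rw [← LinearMap.ker_eq_bot, LinearMap.ker_eq_bot']
  intro y hy
  refine Subtype.ext (IsSolution.eq_zero y.2 fun m hm => ?_)
  exact congrFun hy ⟨m, hm⟩

/-- Solutions are determined by three initial values, and three independent ones are known. -/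
theorem span_eq_solutionSpace (hξ0 : 0 < ξ) (hξ1 : ξ < 1) :
    Submodule.span ℝ {La ξ, Lb ξ, Lc ξ} = solutionSpace ξ := by
  have hfin : FiniteDimensional ℝ (solutionSpace ξ) :=
    FiniteDimensional.of_injective (initialData ξ) (initialData_injective ξ)
  refine Submodule.eq_of_le_of_finrank_le ?_ ?_
  · rw [Submodule.span_le]
    rintro y (rfl | rfl | rfl)
    · exact isSolution_La hξ1
    · exact isSolution_Lb hξ0.le hξ1
    · exact isSolution_Lc hξ0.le hξ1
  · have h1 := LinearMap.finrank_le_finrank_of_injective (initialData_injective ξ)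
    have h2 := finrank_span_eq_card (linearIndependent_La_Lb_Lc hξ0 hξ1)
    rw [Module.finrank_fin_fun] at h1
    have h3 : range ![La ξ, Lb ξ, Lc ξ] = {La ξ, Lb ξ, Lc ξ} := by
      simp only [Matrix.range_cons, Matrix.range_empty, union_empty, singleton_union]
    rw [h3, Fintype.card_fin] at h2
    rw [h2]
    exact h1

theorem nonOscillatoryAtBot_iff (hξ0 : 0 < ξ) (hξ1 : ξ < 1) {y : ℝ → ℝ} (hy : IsSolution ξ y) :
    NonOscillatoryAtBot y ↔ y ∈ Submodule.span ℝ {La ξ} := by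
  rw [Submodule.mem_span_singleton]
  constructor
  · intro h
    have hmem : y ∈ Submodule.span ℝ {La ξ, Lb ξ, Lc ξ} := by
      rw [span_eq_solutionSpace hξ0 hξ1]; exact hy
    obtain ⟨a, b, c, rfl⟩ := Submodule.mem_span_triple.1 hmem
    obtain ⟨rfl, rfl⟩ := coeff_eq_zero_of_nonOscillatory hξ0 hξ1 (a := a) (b := b) (c := c)
      (fun θ => by simp) h
    exact ⟨a, by simp⟩
  · rintro ⟨a, rfl⟩
    exact nonOscillatoryAtBot_smul_La hξ1 a

end

end Langer

theorem mainTheorem2 (ξ : ℝ) (hξ0 : 0 < ξ) (hξ1 : ξ < 1) :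
    -- the three integrals converge
    (∀ θ : ℝ, IntegrableOn (Langer.laIntegrand ξ θ) (Ioi 0)) ∧
    (∀ θ : ℝ, Langer.HasImproperIntegral (Langer.lbIntegrand ξ θ) (Langer.Lb ξ θ)) ∧
    (∀ θ : ℝ, Langer.HasImproperIntegral (Langer.lcIntegrand ξ θ) (Langer.Lc ξ θ)) ∧
    -- they form a basis of the solution space
    LinearIndependent ℝ ![Langer.La ξ, Langer.Lb ξ, Langer.Lc ξ] ∧
    (∀ y : ℝ → ℝ, Langer.IsSolution ξ y ↔
      y ∈ Submodule.span ℝ {Langer.La ξ, Langer.Lb ξ, Langer.Lc ξ}) ∧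
    -- the non-oscillatory solutions as `θ → -∞`
    (∀ y : ℝ → ℝ, Langer.IsSolution ξ y →
      (Langer.NonOscillatoryAtBot y ↔ y ∈ Submodule.span ℝ {Langer.La ξ})) ∧
    -- the form of `La` for `θ < 0`
    (∃ E₂ : ℝ → ℝ, AnalyticOnNhd ℝ E₂ (Ioi 0) ∧ ContDiffOn ℝ ∞ E₂ (Ici 0) ∧
      E₂ 0 = Real.Gamma (1 - ξ) ∧
      ∀ θ : ℝ, θ < 0 →
        Langer.La ξ θ = (-θ) ^ (-(1 - ξ)) * E₂ ((-θ) ^ (-3 : ℤ))) ∧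
    -- asymptotics for `θ → ∞`
    (Langer.La ξ ~[atTop] fun θ : ℝ =>
      √Real.pi * θ ^ ((1 - ξ) / 2 - 3 / 4) * Real.exp (2 * θ ^ (3 / 2 : ℝ) / 3)) ∧
    (Langer.Lb ξ ~[atTop] fun θ : ℝ =>
      √Real.pi / 2 * θ ^ ((1 - ξ) / 2 - 3 / 4) * Real.exp (-2 * θ ^ (3 / 2 : ℝ) / 3)) ∧
    (Langer.Lc ξ ~[atTop] fun θ : ℝ =>
      Real.sin (ξ * Real.pi) * θ ^ (-(1 - ξ)) * Real.Gamma (1 - ξ)) ∧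
    -- asymptotics for `θ → -∞`
    (∃ r : ℝ → ℝ, (r =O[atBot] fun θ : ℝ => θ ^ (-3 : ℤ)) ∧
      ∀ᶠ θ : ℝ in atBot,
        Langer.La ξ θ = (-θ) ^ (-(1 - ξ)) * Real.Gamma (1 - ξ) * (1 + r θ)) ∧
    (∃ δ ε : ℝ → ℝ, (δ =o[atBot] fun θ : ℝ => (-θ) ^ (-(3 / 2) : ℝ)) ∧
      Tendsto ε atBot (𝓝 0) ∧
      ∀ᶠ θ : ℝ in atBot,
        Langer.Lb ξ θ =
          √Real.pi * (-θ) ^ ((1 - ξ) / 2 - 3 / 4) *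
              Real.sin (2 / 3 * (-θ) ^ (3 / 2 : ℝ) * (1 + δ θ)
                + Real.pi / 4 - ξ * Real.pi / 2) * (1 + ε θ)
            + Real.sin (ξ * Real.pi) * Langer.La ξ θ) ∧
    (∃ δ ε : ℝ → ℝ, (δ =o[atBot] fun θ : ℝ => (-θ) ^ (-(3 / 2) : ℝ)) ∧
      Tendsto ε atBot (𝓝 0) ∧
      ∀ᶠ θ : ℝ in atBot,
        Langer.Lc ξ θ =
          √Real.pi * (-θ) ^ ((1 - ξ) / 2 - 3 / 4) *
              Real.sin (2 / 3 * (-θ) ^ (3 / 2 : ℝ) * (1 + δ θ)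
                + Real.pi / 4 + ξ * Real.pi / 2) * (1 + ε θ)) := by
  have hb : ∃ δ ε : ℝ → ℝ, (δ =o[atBot] fun θ : ℝ => (-θ) ^ (-(3 / 2) : ℝ)) ∧
      Tendsto ε atBot (𝓝 0) ∧ ∀ᶠ θ : ℝ in atBot,
        Langer.Lb ξ θ - Real.sin (ξ * Real.pi) * Langer.La ξ θ =
          √Real.pi * (-θ) ^ ((1 - ξ) / 2 - 3 / 4) *
            Real.sin (2 / 3 * (-θ) ^ (3 / 2 : ℝ) * (1 + δ θ)
              + (Real.pi / 4 - ξ * Real.pi / 2)) * (1 + ε θ) := by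
    obtain ⟨η, hη, h⟩ := Langer.exists_oscillation_Lb hξ0.le hξ1
    exact Langer.exists_phase_form hη fun x hx => by rw [h x hx]; ring
  have hc : ∃ δ ε : ℝ → ℝ, (δ =o[atBot] fun θ : ℝ => (-θ) ^ (-(3 / 2) : ℝ)) ∧
      Tendsto ε atBot (𝓝 0) ∧ ∀ᶠ θ : ℝ in atBot,
        Langer.Lc ξ θ =
          √Real.pi * (-θ) ^ ((1 - ξ) / 2 - 3 / 4) *
            Real.sin (2 / 3 * (-θ) ^ (3 / 2 : ℝ) * (1 + δ θ)
              + (Real.pi / 4 + ξ * Real.pi / 2)) * (1 + ε θ) := by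
    obtain ⟨η, hη, h⟩ := Langer.exists_oscillation_Lc hξ0.le hξ1
    exact Langer.exists_phase_form hη h
  refine ⟨fun θ => Langer.integrableOn_laIntegrand hξ1 θ,
    fun θ => Langer.hasImproperIntegral_lbIntegrand hξ0.le hξ1 θ,
    fun θ => Langer.hasImproperIntegral_lcIntegrand hξ0.le hξ1 θ,
    Langer.linearIndependent_La_Lb_Lc hξ0 hξ1, fun y => ?_,
    fun y hy => Langer.nonOscillatoryAtBot_iff hξ0 hξ1 hy,
    ⟨Langer.laplaceCube (-ξ), Langer.analyticOnNhd_laplaceCube (by linarith),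
      contDiffOn_infty.2 fun n => Langer.contDiffOn_laplaceCube n (by linarith),
      Langer.laplaceCube_zero ξ hξ1, ?_⟩,
    Langer.La_isEquivalent_atTop hξ0.le hξ1, Langer.Lb_isEquivalent_atTop hξ0.le hξ1,
    Langer.Lc_isEquivalent_atTop hξ0 hξ1, Langer.La_asymptotic_atBot hξ1, ?_, ?_⟩
  · rw [Langer.span_eq_solutionSpace hξ0 hξ1]
    rfl
  · intro θ hθ
    have h := Langer.La_neg_eq ξ (neg_pos.2 hθ)
    rw [neg_neg] at h
    rw [h, zpow_neg, inv_pow]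
    rfl
  · obtain ⟨δ, ε, hδ, hε, h⟩ := hb
    refine ⟨δ, ε, hδ, hε, h.mono fun θ hθ => ?_⟩
    rw [add_sub_assoc, ← hθ, sub_add_cancel]
  · obtain ⟨δ, ε, hδ, hε, h⟩ := hc
    refine ⟨δ, ε, hδ, hε, h.mono fun θ hθ => ?_⟩
    rw [add_assoc, ← hθ]
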